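/- For a trigonometric polynomial $p$ let $\mathcal C_p\subset\mathbb R^2$ be the image of $[-\pi,\pi]$ under $\gamma(\theta)=(p(\theta)\cos\theta-p'(\theta)\sin\theta,\ p(\theta)\sin\theta+p'(\theta)\cos\theta)$. For an integer $n\ge 3$ and $\rho>0$, an algebraic rotor of a regular $n$-gon with apothem $\rho$ is a curve $\mathcal C_p$ where $p+p''\ge 0$ on $\mathbb R$ and, for some integer $m\ge 0$ and some real coefficients, $$p(\theta)=\rho+\sum_{k=0}^{m}\bigl(a_{kn+1}\cos((kn+1)\theta)+b_{kn+1}\sin((kn+1)\theta)+a_{kn-1}\cos((kn-1)\theta)+b_{kn-1}\sin((kn-1)\theta)\bigr).$$ Let $\mathcal R$ be the set of all algebraic rotors, for all $n\ge 3$ and all $\rho>0$. A defining polynomial of a curve $\mathcal C$ is an irreducible $f\in\mathbb R[x,y]$ such that the polynomials in $\mathbb R[x,y]$ vanishing on $\mathcal C$ are exactly the multiples of $f$; it is unique up to a nonzero constant factor. **Theorem.** Every curve of $\mathcal R$ that is not a circle has a defining polynomial, and the minimum of the total degrees of the defining polynomials of all non-circular curves of $\mathcal R$ is $6$. Moreover,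 let $p(\theta)=\tfrac12+a_1\cos\theta+b_1\sin\theta+a_2\cos2\theta+b_2\sin2\theta$ with real coefficients. If $(a_2,b_2)\neq(0,0)$ and $p+p''\ge0$, then $\mathcal C_p$ is a non-circular algebraic rotor of a regular triangle with apothem $\tfrac12$, and its defining polynomial has total degree $6$. There is $\varepsilon>0$ such that $p+p''\ge 0$ whenever $|a_2|<\varepsilon$ and $|b_2|<\varepsilon$, for all $a_1,b_1$. In particular $p(\theta)=\tfrac12+\tfrac16\cos2\theta$ satisfies $p+p''\ge0$, and $\mathcal C_p$ is a non-circular algebraic rotor of a regular triangle with apothem $\tfrac12$ whose defining polynomial has total degree $6$. -/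

import Mathlib

open scoped BigOperators

noncomputable section

/-- The Euclidean plane. -/
abbrev Plane : Type := EuclideanSpace ℝ (Fin 2)

/-- `γ(θ) = (p(θ) cos θ - p'(θ) sin θ, p(θ) sin θ + p'(θ) cos θ)`. -/
def supportParam (p : ℝ → ℝ) (θ : ℝ) : Plane :=
  !₂[p θ * Real.cos θ - deriv p θ * Real.sin θ, p θ * Real.sin θ + deriv p θ * Real.cos θ]

/-- The planar curve traced by `γ` on `[-π, π]`. -/
def supportCurve (p : ℝ → ℝ) : Set Plane :=
  supportParam p '' Set.Icc (-Real.pi) Real.pi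

/-- The convexity constraint `p + p'' ≥ 0` (used for smooth `p` only). -/
def ConvexityConstraint (p : ℝ → ℝ) : Prop :=
  ∀ θ : ℝ, 0 ≤ p θ + deriv (deriv p) θ

/-- The trigonometric polynomial with constant term `ρ` and harmonics of order `kn ± 1`,
`0 ≤ k ≤ m`; the coefficients of `cos jθ` and `sin jθ` are `a j` and `b j`. -/
def rotorSupport (n : ℕ) (ρ : ℝ) (m : ℕ) (a b : ℤ → ℝ) (θ : ℝ) : ℝ :=
  ρ + ∑ k ∈ Finset.range (m + 1),
    (a ((k : ℤ) * n + 1) * Real.cos (((k : ℝ) * n + 1) * θ)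
      + b ((k : ℤ) * n + 1) * Real.sin (((k : ℝ) * n + 1) * θ)
      + a ((k : ℤ) * n - 1) * Real.cos (((k : ℝ) * n - 1) * θ)
      + b ((k : ℤ) * n - 1) * Real.sin (((k : ℝ) * n - 1) * θ))

/-- `C` is an algebraic rotor of a regular `n`-gon with apothem `ρ`. -/
def IsAlgebraicRotor (n : ℕ) (ρ : ℝ) (C : Set Plane) : Prop :=
  3 ≤ n ∧ 0 < ρ ∧ ∃ (m : ℕ) (a b : ℤ → ℝ),
    ConvexityConstraint (rotorSupport n ρ m a b) ∧ C = supportCurve (rotorSupport n ρ m a b)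

/-- The set of all planar algebraic rotors, for all `n ≥ 3` and all apothems `ρ > 0`. -/
def algebraicRotors : Set (Set Plane) :=
  {C | ∃ (n : ℕ) (ρ : ℝ), IsAlgebraicRotor n ρ C}

/-- `C` is a circle of positive radius. -/
def IsCircle (C : Set Plane) : Prop :=
  ∃ (c : Plane) (r : ℝ), 0 < r ∧ C = Metric.sphere c r

/-- `f ∈ ℝ[x, y]` is a defining polynomial of `C`: it is irreducible, and the polynomials that
vanish on `C` are exactly the multiples of `f`. In particular `f` is unique up to a nonzero
constant factor. -/
def IsDefiningPolynomial (f : MvPolynomial (Fin 2) ℝ) (C : Set Plane) : Prop :=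
  Irreducible f ∧
    ∀ g : MvPolynomial (Fin 2) ℝ, (∀ z ∈ C, MvPolynomial.eval (fun i => z i) g = 0) ↔ f ∣ g

/-- `p(θ) = 1/2 + a₁ cos θ + b₁ sin θ + a₂ cos 2θ + b₂ sin 2θ`. -/
def quadraticSupport (a₁ b₁ a₂ b₂ : ℝ) (θ : ℝ) : ℝ :=
  1 / 2 + a₁ * Real.cos θ + b₁ * Real.sin θ + a₂ * Real.cos (2 * θ) + b₂ * Real.sin (2 * θ)

end

/-! The first harmonics only translate the curve. Write `Z = (x - α) + i (y - β)`, `W = (x - α) - i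
(y - β)` and `s = exp (-iθ)`. If `N ≥ 2` is the top frequency of the rest of `p`, then `s ^ (N + 1)
* Z` and `s ^ (N - 1) * W` are polynomials in `s` with nonzero constant terms; conjugation gives the
same with the exponents exchanged.

Lower bound: let `F (Z, W)` vanish on the curve. Its part of top weight `(N + 1, N - 1)` cannot be a
single monomial, for that would be the only term of lowest order in `s`. So the Newton polygon of
`F` has an edge in this direction and, by symmetry, one in direction `(N - 1, N + 1)`. Lattice edges
with these normals are long, and convexity yields a monomial with both exponents at least `d = (N +
1) / gcd (N + 1, N - 1)`. Hence the degree is at least `2 * d ≥ 6`, except when `N = 3`, where `d =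
2`; there the second harmonic is absent, everything depends on `s ^ 3`, and the next coefficient
excludes degree at most 5 (`six_le_of_weight_four_two`).

Existence: the vanishing ideal is prime because the curve is parametrized by Laurent polynomials on
the circle, nonzero by a dimension count, and meets `ℝ[y]` trivially; such an ideal of `ℝ[y][x]` is
principal.

Sharpness: for `N = 2` an explicit elimination gives a sextic. -/

/-! ### Algebraic preliminaries. -/

/-- The generator is an irreducible factor, lying in the prime ideal, of an element of least degree.
-/
theorem Polynomial.exists_irreducible_forall_mem_iff_dvd {R : Type*} [CommRing R] [IsDomain R]
    [UniqueFactorizationMonoid R] (I : Ideal (Polynomial R)) [hI : I.IsPrime]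
    (hne : ∃ f ∈ I, f ≠ 0) (hC : ∀ r : R, Polynomial.C r ∈ I → r = 0) :
    ∃ f, Irreducible f ∧ ∀ g, g ∈ I ↔ f ∣ g := by
  classical
  have hex : ∃ d, ∃ f ∈ I, f ≠ 0 ∧ f.natDegree = d := by
    obtain ⟨f, hf, h0⟩ := hne
    exact ⟨_, f, hf, h0, rfl⟩
  obtain ⟨f, hfI, hf0, hfd⟩ := Nat.find_spec hex
  have hmin : ∀ g ∈ I, g ≠ 0 → Nat.find hex ≤ g.natDegree := fun g hg h0 =>
    Nat.find_min' hex ⟨g, hg, h0, rfl⟩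
  obtain ⟨q, hqI, hq, hqf⟩ : ∃ q ∈ I, Irreducible q ∧ q ∣ f := by
    clear hfd
    induction f using WfDvdMonoid.induction_on_irreducible with
    | zero => exact absurd rfl hf0
    | unit u hu => exact absurd (Ideal.eq_top_of_isUnit_mem _ hfI hu) hI.ne_top
    | mul a i ha hi ih =>
      rcases hI.mem_or_mem hfI with h | h
      · exact ⟨i, h, hi, dvd_mul_right _ _⟩
      · obtain ⟨q, h1, h2, h3⟩ := ih h ha
        exact ⟨q, h1, h2, h3.mul_left _⟩
  have hqd : q.natDegree = Nat.find hex :=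
    le_antisymm (hfd ▸ Polynomial.natDegree_le_of_dvd hqf hf0) (hmin q hqI hq.ne_zero)
  have hpos : 0 < q.natDegree := by
    rcases Nat.eq_zero_or_pos q.natDegree with h | h
    · rw [Polynomial.natDegree_eq_zero] at h
      obtain ⟨r, rfl⟩ := h
      have := hC r hqI
      exact absurd (by simp [this]) hq.ne_zero
    · exact h
  refine ⟨q, hq, fun g => ⟨?_, fun h => Ideal.mem_of_dvd _ h hqI⟩⟩
  have key : ∀ n, ∀ g ∈ I, g.natDegree < n → q ∣ g := by
    intro n
    induction n with
    | zero => intro g _ h; omega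
    | succ n ih =>
      intro g hg hgn
      by_cases hg0 : g = 0
      · simp [hg0]
      have hle : q.natDegree ≤ g.natDegree := hqd ▸ hmin g hg hg0
      -- Pseudo-division: `g` is scaled by the leading coefficient of `q`, which need not be a unit.
      -- This factor is removed at the end, since `q` is prime of positive degree and cannot divide
      -- a nonzero constant.
      set h : Polynomial R := Polynomial.C q.leadingCoeff * g
        - Polynomial.C g.leadingCoeff * Polynomial.X ^ (g.natDegree - q.natDegree) * q with hh
      have hhI : h ∈ I := I.sub_mem (I.mul_mem_left _ hg) (I.mul_mem_left _ hqI)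
      have hdvd : q ∣ h := by
        by_cases h0 : h = 0
        · simp [h0]
        refine ih h hhI ?_
        have : h.natDegree < g.natDegree := by
          have hle' : h.natDegree ≤ g.natDegree := by
            refine (Polynomial.natDegree_sub_le _ _).trans (max_le ?_ ?_)
            · exact Polynomial.natDegree_C_mul_le _ _
            · refine (Polynomial.natDegree_mul_le).trans ?_
              have := Polynomial.natDegree_C_mul_X_pow_le g.leadingCoeff
                (g.natDegree - q.natDegree)
              omega
          refine lt_of_le_of_ne hle' fun he => h0 ?_
          rw [← Polynomial.leadingCoeff_eq_zero, Polynomial.leadingCoeff, he, hh]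
          simp only [Polynomial.coeff_sub, Polynomial.coeff_C_mul, mul_assoc]
          rw [Polynomial.coeff_X_pow_mul', if_pos (Nat.sub_le _ _), Nat.sub_sub_self hle]
          simp [mul_comm]
        omega
      have h2 : q ∣ Polynomial.C q.leadingCoeff * g := by
        have := dvd_add hdvd (Dvd.intro_left (Polynomial.C g.leadingCoeff *
          Polynomial.X ^ (g.natDegree - q.natDegree)) rfl)
        rwa [hh, sub_add_cancel] at this
      rcases hq.prime.dvd_or_dvd h2 with h3 | h3
      · have := Polynomial.natDegree_le_of_dvd h3 (by simpa using hq.ne_zero)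
        rw [Polynomial.natDegree_C] at this
        omega
      · exact h3
  exact fun hg => key _ g hg (Nat.lt_succ_self _)

theorem MvPolynomial.totalDegree_aeval_le_of_totalDegree_le_one {σ τ R S : Type*}
    [CommSemiring R] [CommSemiring S] [Algebra R S] (f : MvPolynomial σ R)
    (g : σ → MvPolynomial τ S) (hg : ∀ i, (g i).totalDegree ≤ 1) :
    (MvPolynomial.aeval g f).totalDegree ≤ f.totalDegree := by
  rw [MvPolynomial.aeval_def, MvPolynomial.eval₂_eq]
  refine MvPolynomial.totalDegree_finsetSum_le fun m hm => ?_
  refine (MvPolynomial.totalDegree_mul _ _).trans ?_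
  have h1 : (algebraMap R (MvPolynomial τ S) (f.coeff m)).totalDegree = 0 := by
    rw [IsScalarTower.algebraMap_apply R S (MvPolynomial τ S), MvPolynomial.algebraMap_eq,
      MvPolynomial.totalDegree_C]
  rw [h1, zero_add]
  refine (MvPolynomial.totalDegree_finsetProd _ _).trans ?_
  refine le_trans (Finset.sum_le_sum fun i _ => ?_) (MvPolynomial.le_totalDegree hm)
  refine (MvPolynomial.totalDegree_pow _ _).trans ?_
  simpa using Nat.mul_le_mul_left (m i) (hg i)

/-! ### Rational parametrizations by the unit circle. -/

theorem infinite_unit_circle : {s : ℂ | ‖s‖ = 1}.Infinite := by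
  have h : (Complex.arg '' {s : ℂ | ‖s‖ = 1}).Infinite := by
    refine (Set.Ioc_infinite (show -Real.pi < Real.pi by linarith [Real.pi_pos])).mono ?_
    intro θ hθ
    refine ⟨Complex.exp (θ * Complex.I), by simp [Complex.norm_exp], ?_⟩
    rw [Complex.arg_exp_mul_I, toIocMod_eq_self]
    simpa [two_mul] using hθ
  exact h.of_image _

theorem Polynomial.eq_zero_of_forall_norm_eq_one (p : Polynomial ℂ)
    (h : ∀ s : ℂ, ‖s‖ = 1 → p.eval s = 0) : p = 0 :=
  Polynomial.eq_zero_of_infinite_isRoot p (infinite_unit_circle.mono fun s hs => h s hs)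

/-- Every polynomial in two rational functions `P / s ^ K`, `Q / s ^ K` is of the form `G / s ^ M`. -/
theorem MvPolynomial.exists_numerator (K : ℕ) (P : Fin 2 → Polynomial ℂ) (g : MvPolynomial (Fin 2) ℝ) :
    ∃ (M : ℕ) (G : Polynomial ℂ), ∀ (s : ℂ) (z : Fin 2 → ℝ),
      (∀ i, s ^ K * z i = (P i).eval s) → s ^ M * (MvPolynomial.eval z g : ℝ) = G.eval s := by
  induction g using MvPolynomial.induction_on with
  | C a => exact ⟨0, Polynomial.C (a : ℂ), fun s z _ => by simp⟩
  | add p q hp hq =>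
    obtain ⟨M, G, h⟩ := hp
    obtain ⟨M', G', h'⟩ := hq
    refine ⟨M + M', Polynomial.X ^ M' * G + Polynomial.X ^ M * G', fun s z hz => ?_⟩
    simp only [map_add, Complex.ofReal_add, Polynomial.eval_add, Polynomial.eval_mul,
      Polynomial.eval_pow, Polynomial.eval_X, ← h s z hz, ← h' s z hz]
    ring
  | mul_X p i hp =>
    obtain ⟨M, G, h⟩ := hp
    refine ⟨M + K, G * P i, fun s z hz => ?_⟩
    simp only [map_mul, MvPolynomial.eval_X, Complex.ofReal_mul, Polynomial.eval_mul,
      ← h s z hz, ← hz i]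
    ring

/-- Dimension count: the monomials of bidegree at most `(D, D)`, brought to the common denominator
`s ^ (2 * K * D)`, outnumber the real dimension of the space containing their numerators. Linear
dependence is taken over `ℝ` so that the relation has real coefficients. -/
theorem exists_ne_zero_algebraic_relation (K : ℕ) (P : Fin 2 → Polynomial ℂ) :
    ∃ h : MvPolynomial (Fin 2) ℝ, h ≠ 0 ∧ ∀ (s : ℂ) (z : Fin 2 → ℝ), s ≠ 0 →
      (∀ i, s ^ K * z i = (P i).eval s) → MvPolynomial.eval z h = 0 := by
  classical
  obtain ⟨B, hB, hB0, hB1⟩ : ∃ B, K ≤ B ∧ (P 0).natDegree ≤ B ∧ (P 1).natDegree ≤ B :=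
    ⟨K + (P 0).natDegree + (P 1).natDegree, by omega, by omega, by omega⟩
  -- With this `D`, `(D + 1) ^ 2 > 2 * n`; the factor 2 is the real dimension of `ℂ`.
  set D := 4 * B + 1 with hD
  set n := 2 * B * D + 1 with hn
  let W : Fin (D + 1) × Fin (D + 1) → Polynomial ℂ := fun e =>
    P 0 ^ (e.1 : ℕ) * P 1 ^ (e.2 : ℕ) * Polynomial.X ^ (K * (2 * D - e.1 - e.2))
  have hW : ∀ e, (W e).natDegree < n := by
    rintro ⟨⟨i, hi⟩, ⟨j, hj⟩⟩
    refine Nat.lt_succ_of_le ?_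
    refine (Polynomial.natDegree_mul_le.trans (add_le_add Polynomial.natDegree_mul_le le_rfl)).trans ?_
    have h1 := Polynomial.natDegree_pow_le_of_le i hB0
    have h2 := Polynomial.natDegree_pow_le_of_le j hB1
    rw [Polynomial.natDegree_X_pow]
    have h3 : K * (2 * D - i - j) ≤ B * (2 * D - i - j) := Nat.mul_le_mul_right _ hB
    have h4 : i * B + j * B + B * (2 * D - i - j) = 2 * B * D := by
      obtain ⟨k, hk⟩ : ∃ k, 2 * D = i + j + k := ⟨2 * D - i - j, by omega⟩
      have : 2 * D - i - j = k := by omega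
      rw [this, mul_comm 2 B, mul_assoc, hk]; ring
    simp only at *
    omega
  have hdep : ¬ LinearIndependent ℝ (fun e => fun k : Fin n => (W e).coeff k) := by
    intro hli
    have := hli.fintype_card_le_finrank
    rw [Module.finrank_pi_fintype] at this
    simp only [Fintype.card_prod, Fintype.card_fin, Complex.finrank_real_complex,
      Finset.sum_const, Finset.card_univ, smul_eq_mul, hn] at this
    nlinarith
  rw [Fintype.not_linearIndependent_iff] at hdep
  obtain ⟨c, hc, ⟨e₀, he₀⟩⟩ := hdep
  let ex : Fin (D + 1) × Fin (D + 1) → Fin 2 →₀ ℕ := fun e =>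
    Finsupp.single 0 (e.1 : ℕ) + Finsupp.single 1 (e.2 : ℕ)
  have hex : Function.Injective ex := by
    rintro ⟨i, j⟩ ⟨i', j'⟩ h
    have h0 := DFunLike.congr_fun h 0
    have h1 := DFunLike.congr_fun h 1
    simp [ex] at h0 h1
    ext <;> simp [h0, h1]
  have hsum : ∑ e, Polynomial.C (c e : ℂ) * W e = 0 := by
    ext k
    by_cases hk : k < n
    · have := congrFun hc ⟨k, hk⟩
      simpa [Polynomial.finsetSum_coeff] using this
    · rw [Polynomial.finsetSum_coeff]
      refine Finset.sum_eq_zero fun e _ => ?_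
      rw [Polynomial.coeff_C_mul, Polynomial.coeff_eq_zero_of_natDegree_lt
        ((hW e).trans_le (not_lt.mp hk)), mul_zero]
  refine ⟨∑ e, MvPolynomial.monomial (ex e) (c e), fun h => he₀ ?_, fun s z hs hz => ?_⟩
  · have := congrArg (MvPolynomial.coeff (ex e₀)) h
    rw [MvPolynomial.coeff_sum, Finset.sum_eq_single e₀] at this
    · simpa using this
    · intro e _ he
      rw [MvPolynomial.coeff_monomial, if_neg fun h => he (hex h)]
    · simp
  · have h1 := congrArg (Polynomial.eval s) hsum
    rw [Polynomial.eval_finsetSum] at h1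
    have h2 : ∀ e, (Polynomial.C (c e : ℂ) * W e).eval s =
        s ^ (K * (2 * D)) * ((c e * (z 0 ^ (e.1 : ℕ) * z 1 ^ (e.2 : ℕ)) : ℝ) : ℂ) := by
      rintro ⟨⟨i, hi⟩, ⟨j, hj⟩⟩
      obtain ⟨k, hk⟩ : ∃ k, 2 * D = i + j + k := ⟨2 * D - i - j, by omega⟩
      have : i + j + k - i - j = k := by omega
      simp only [W, Polynomial.eval_mul, Polynomial.eval_C, Polynomial.eval_pow,
        Polynomial.eval_X, ← hz, hk, this]
      push_cast
      ring
    simp only [h2, ← Finset.mul_sum, Polynomial.eval_zero] at h1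
    rcases mul_eq_zero.mp h1 with h3 | h3
    · exact absurd h3 (pow_ne_zero _ hs)
    · rw [← Complex.ofReal_sum, Complex.ofReal_eq_zero] at h3
      rw [map_sum, ← h3]
      refine Finset.sum_congr rfl fun e _ => ?_
      rw [MvPolynomial.eval_monomial]
      congr 1
      rw [Finsupp.prod_fintype _ _ (by simp)]
      simp [ex]

/-! ### Degree bound from the Newton polygon. -/

/-- The left side is `s ^ U * F (z)` as a polynomial in `s`; it has infinitely many zeros. -/
theorem sum_face_eq_zero (F : MvPolynomial (Fin 2) ℂ) (a : Fin 2 → ℕ) (p : Fin 2 → Polynomial ℂ)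
    (U : ℕ) (hU : ∀ m ∈ F.support, a 0 * m 0 + a 1 * m 1 ≤ U)
    (h : ∀ s : ℂ, ‖s‖ = 1 → ∃ z : Fin 2 → ℂ,
      (∀ i, s ^ a i * z i = (p i).eval s) ∧ MvPolynomial.eval z F = 0) :
    ∑ m ∈ F.support, Polynomial.C (F.coeff m) * (p 0 ^ m 0 * p 1 ^ m 1) *
      Polynomial.X ^ (U - (a 0 * m 0 + a 1 * m 1)) = 0 := by
  refine Polynomial.eq_zero_of_forall_norm_eq_one _ fun s hs => ?_
  obtain ⟨z, hz, hF⟩ := h s hs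
  rw [MvPolynomial.eval_eq'] at hF
  rw [Polynomial.eval_finsetSum, ← mul_zero (s ^ U), ← hF, Finset.mul_sum]
  refine Finset.sum_congr rfl fun m hm => ?_
  obtain ⟨k, hk⟩ := Nat.exists_eq_add_of_le (hU m hm)
  simp only [Polynomial.eval_mul, Polynomial.eval_C, Polynomial.eval_pow, Polynomial.eval_X,
    ← hz, Fin.prod_univ_two, hk, Nat.add_sub_cancel_left]
  ring

/-- Only monomials of top weight reach the constant coefficient, and a single one would contribute a
nonzero number. -/
theorem exists_ne_mem_face (F : MvPolynomial (Fin 2) ℂ) (a : Fin 2 → ℕ) (p : Fin 2 → Polynomial ℂ)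
    (hp : ∀ i, (p i).coeff 0 ≠ 0)
    (h : ∀ s : ℂ, ‖s‖ = 1 → ∃ z : Fin 2 → ℂ,
      (∀ i, s ^ a i * z i = (p i).eval s) ∧ MvPolynomial.eval z F = 0)
    (m : Fin 2 →₀ ℕ) (hm : m ∈ F.support)
    (hmax : ∀ m' ∈ F.support, a 0 * m' 0 + a 1 * m' 1 ≤ a 0 * m 0 + a 1 * m 1) :
    ∃ m' ∈ F.support, m' ≠ m ∧ a 0 * m' 0 + a 1 * m' 1 = a 0 * m 0 + a 1 * m 1 := by
  by_contra! hcon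
  have h0 := congrArg (fun q => Polynomial.coeff q 0) (sum_face_eq_zero F a p _ hmax h)
  simp only [Polynomial.finsetSum_coeff, Polynomial.coeff_zero] at h0
  rw [Finset.sum_eq_single m] at h0
  · simp only [Nat.sub_self, pow_zero, mul_one, Polynomial.coeff_zero_eq_eval_zero] at h0
    simp only [Polynomial.coeff_zero_eq_eval_zero] at hp
    rw [Polynomial.eval_mul, Polynomial.eval_C, Polynomial.eval_mul, Polynomial.eval_pow,
      Polynomial.eval_pow] at h0
    exact mul_ne_zero (MvPolynomial.mem_support_iff.mp hm)
      (mul_ne_zero (pow_ne_zero _ (hp 0)) (pow_ne_zero _ (hp 1))) h0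
  · intro m' hm' hne
    have h1 := hmax m' hm'
    have h2 := hcon m' hm' hne
    rw [Polynomial.coeff_mul_X_pow', if_neg (by omega)]
  · exact fun h => absurd hm h

/-- `A` and `B` are the endpoints, facing each other, of the two edges. The edge lengths give `d ≤ A
1` and `d ≤ B 0`, and convexity gives `B 0 ≤ A 0`. -/
theorem exists_vertex_of_faces (S : Finset (Fin 2 →₀ ℕ)) (hS : S.Nonempty) (a b d : ℕ) (hab : b < a)
    (hd : ∀ x y : ℕ, a * x = b * y → d ∣ y)
    (h₁ : ∀ m ∈ S, (∀ m' ∈ S, a * m' 0 + b * m' 1 ≤ a * m 0 + b * m 1) →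
      ∃ m' ∈ S, m' ≠ m ∧ a * m' 0 + b * m' 1 = a * m 0 + b * m 1)
    (h₂ : ∀ m ∈ S, (∀ m' ∈ S, b * m' 0 + a * m' 1 ≤ b * m 0 + a * m 1) →
      ∃ m' ∈ S, m' ≠ m ∧ b * m' 0 + a * m' 1 = b * m 0 + a * m 1) :
    ∃ A ∈ S, (∀ m ∈ S, a * m 0 + b * m 1 ≤ a * A 0 + b * A 1) ∧
      (∀ m ∈ S, a * m 0 + b * m 1 = a * A 0 + b * A 1 → m 1 ≤ A 1) ∧ d ≤ A 0 ∧ d ≤ A 1 := by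
  have hne : ∀ m m' : Fin 2 →₀ ℕ, m ≠ m' → m 0 ≠ m' 0 ∨ m 1 ≠ m' 1 := by
    intro m m' h
    by_contra! hc
    refine h (Finsupp.ext fun i => ?_)
    fin_cases i
    · exact hc.1
    · exact hc.2
  obtain ⟨A₀, hA₀, hmaxA₀⟩ := S.exists_max_image (fun m => a * m 0 + b * m 1) hS
  obtain ⟨B₀, hB₀, hmaxB₀⟩ := S.exists_max_image (fun m => b * m 0 + a * m 1) hS
  obtain ⟨A, hA, hmaxA⟩ := (S.filter fun m => a * m 0 + b * m 1 = a * A₀ 0 + b * A₀ 1).exists_max_image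
    (fun m => m 1) ⟨A₀, by simp [hA₀]⟩
  obtain ⟨B, hB, hmaxB⟩ := (S.filter fun m => b * m 0 + a * m 1 = b * B₀ 0 + a * B₀ 1).exists_max_image
    (fun m => m 0) ⟨B₀, by simp [hB₀]⟩
  simp only [Finset.mem_filter, and_imp] at hA hB hmaxA hmaxB
  simp only [← hA.2] at hmaxA hmaxA₀
  simp only [← hB.2] at hmaxB hmaxB₀
  have hA1 : d ≤ A 1 := by
    obtain ⟨m, hm, hmne, hw⟩ := h₁ A hA.1 hmaxA₀
    have hle := hmaxA m hm hw
    have hlt : m 1 < A 1 := by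
      refine lt_of_le_of_ne hle fun h => ?_
      rcases hne m A hmne with h' | h'
      · rw [h] at hw
        exact h' (Nat.eq_of_mul_eq_mul_left (by omega) (Nat.add_right_cancel hw))
      · exact h' h
    have h0 : A 0 ≤ m 0 := by
      by_contra! hc
      have := Nat.mul_lt_mul_of_pos_left hc (show 0 < a by omega)
      have := Nat.mul_le_mul_left b hle
      omega
    obtain ⟨x, hx⟩ := Nat.exists_eq_add_of_le h0
    obtain ⟨y, hy⟩ := Nat.exists_eq_add_of_lt hlt
    have := hd x (y + 1) (by rw [hx, hy] at hw; linarith)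
    have := Nat.le_of_dvd (by omega) this
    omega
  have hB0 : d ≤ B 0 := by
    obtain ⟨m, hm, hmne, hw⟩ := h₂ B hB.1 hmaxB₀
    have hle := hmaxB m hm hw
    have hlt : m 0 < B 0 := by
      refine lt_of_le_of_ne hle fun h => ?_
      rcases hne m B hmne with h' | h'
      · exact h' h
      · rw [h] at hw
        exact h' (Nat.eq_of_mul_eq_mul_left (by omega) (Nat.add_left_cancel hw))
    have h0 : B 1 ≤ m 1 := by
      by_contra! hc
      have := Nat.mul_lt_mul_of_pos_left hc (show 0 < a by omega)
      have := Nat.mul_le_mul_left b hle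
      omega
    obtain ⟨x, hx⟩ := Nat.exists_eq_add_of_le h0
    obtain ⟨y, hy⟩ := Nat.exists_eq_add_of_lt hlt
    have := hd x (y + 1) (by rw [hx, hy] at hw; linarith)
    have := Nat.le_of_dvd (by omega) this
    omega
  refine ⟨A, hA.1, hmaxA₀, hmaxA, hB0.trans ?_, hA1⟩
  -- Adding `a` times `e1` to `b` times `e2` gives `(a² - b²) (B 0 - A 0) ≤ 0`.
  by_contra! hc
  have e1 := hmaxA₀ B hB.1
  have e2 := hmaxB₀ A hA.1
  zify at *
  nlinarith [mul_le_mul_of_nonneg_left e1 (show (0 : ℤ) ≤ a by omega),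
    mul_le_mul_of_nonneg_left e2 (show (0 : ℤ) ≤ b by omega),
    mul_pos (show (0 : ℤ) < a - b by omega) (show (0 : ℤ) < a + b by omega),
    mul_pos (mul_pos (show (0 : ℤ) < a - b by omega) (show (0 : ℤ) < a + b by omega))
      (show (0 : ℤ) < B 0 - A 0 by omega)]

/-- Here `d = (N + 1) / gcd (N + 1, N - 1)`: it is `N + 1` for even `N` and `(N + 1) / 2` for odd
`N`. -/
theorem exists_three_le_dvd (N : ℕ) (hN : 2 ≤ N) (h3 : N ≠ 3) :
    ∃ d, 3 ≤ d ∧ ∀ x y : ℕ, (N + 1) * x = (N - 1) * y → d ∣ y := by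
  rcases Nat.even_or_odd' N with ⟨M, rfl | rfl⟩
  · refine ⟨2 * M + 1, by omega, fun x y h => ?_⟩
    have hc : Nat.Coprime (2 * M + 1) (2 * M - 1) := by
      have : 2 * M + 1 = (2 * M - 1) + 2 := by omega
      rw [this, Nat.coprime_self_add_left]
      exact (Nat.coprime_two_left).mpr ⟨M - 1, by omega⟩
    exact hc.dvd_of_dvd_mul_left (Dvd.intro _ h)
  · refine ⟨M + 1, by omega, fun x y h => ?_⟩
    have hc : Nat.Coprime (M + 1) M := by simp
    refine hc.dvd_of_dvd_mul_left (Dvd.intro x ?_)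
    have : 2 * M + 1 - 1 = 2 * M := by omega
    rw [this] at h
    nlinarith

/-- In degree at most 5 the top face has at most two monomials, so `c * Q ^ 2 + c' * P` would vanish
modulo `t ^ 2`, where `t = s ^ 3`. The hypothesis `hPQ` forbids this. -/
theorem six_le_of_weight_four_two (F : MvPolynomial (Fin 2) ℂ) (P Q : Polynomial ℂ)
    (hP : P.coeff 0 ≠ 0) (hQ : Q.coeff 0 ≠ 0)
    (hPQ : 2 * Q.coeff 1 * P.coeff 0 ≠ Q.coeff 0 * P.coeff 1)
    (h : ∀ s : ℂ, ‖s‖ = 1 → ∃ z : Fin 2 → ℂ,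
      (∀ i, s ^ (![4, 2] : Fin 2 → ℕ) i * z i =
        ((![Polynomial.expand ℂ 3 P, Polynomial.expand ℂ 3 Q] : Fin 2 → Polynomial ℂ) i).eval s) ∧
      MvPolynomial.eval z F = 0)
    (A : Fin 2 →₀ ℕ) (hA : A ∈ F.support)
    (hmax : ∀ m ∈ F.support, 4 * m 0 + 2 * m 1 ≤ 4 * A 0 + 2 * A 1)
    (hmax' : ∀ m ∈ F.support, 4 * m 0 + 2 * m 1 = 4 * A 0 + 2 * A 1 → m 1 ≤ A 1)
    (h0 : 2 ≤ A 0) (h1 : 2 ≤ A 1) : 6 ≤ F.totalDegree := by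
  by_contra! hdeg
  have hdeg' : ∀ m ∈ F.support, m 0 + m 1 ≤ 5 := by
    intro m hm
    have := MvPolynomial.le_totalDegree hm
    rw [Finsupp.sum_fintype _ _ (by simp), Fin.sum_univ_two] at this
    omega
  have hA5 := hdeg' A hA
  set A' : Fin 2 →₀ ℕ := Finsupp.single 0 (A 0 + 1) + Finsupp.single 1 (A 1 - 2) with hA'
  have hA'0 : A' 0 = A 0 + 1 := by simp [hA']
  have hA'1 : A' 1 = A 1 - 2 := by simp [hA']
  have hAA' : A ≠ A' := fun h => by
    have := DFunLike.congr_fun h 0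
    omega
  -- On the face `m 1` drops from `A 1` in steps of 2, and `A 1 ≤ 3` leaves room for one step.
  have hface : ∀ m ∈ F.support, 4 * m 0 + 2 * m 1 = 4 * A 0 + 2 * A 1 → m = A ∨ m = A' := by
    intro m hm hw
    have := hmax' m hm hw
    have h2 : m 1 = A 1 ∨ m 1 = A 1 - 2 := by omega
    rcases h2 with h2 | h2
    · left
      ext i; fin_cases i
      · show m 0 = A 0
        omega
      · exact h2
    · right
      ext i; fin_cases i
      · show m 0 = A' 0
        omega
      · show m 1 = A' 1
        omega
  have hsum := sum_face_eq_zero F ![4, 2] ![Polynomial.expand ℂ 3 P, Polynomial.expand ℂ 3 Q]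
    (4 * A 0 + 2 * A 1) hmax h
  simp only [Matrix.cons_val_zero, Matrix.cons_val_one, ← map_pow, ← map_mul] at hsum
  set R : Polynomial ℂ := P ^ A 0 * Q ^ (A 1 - 2) with hR
  set E : Polynomial ℂ := Polynomial.C (F.coeff A) * Q ^ 2 + Polynomial.C (F.coeff A') * P with hE
  have key : ∀ k, k ≤ 1 → (R * E).coeff k = 0 := by
    intro k hk
    have hk0 := congrArg (fun q => Polynomial.coeff q (3 * k)) hsum
    simp only [Polynomial.finsetSum_coeff, Polynomial.coeff_zero] at hk0
    have hRE : R * E = Polynomial.C (F.coeff A) * (P ^ A 0 * Q ^ A 1) +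
        Polynomial.C (F.coeff A') * (P ^ A' 0 * Q ^ A' 1) := by
      obtain ⟨y, hy⟩ := Nat.exists_eq_add_of_le h1
      rw [hA'0, hA'1, hR, hE, hy, Nat.add_sub_cancel_left]
      ring
    have hw' : 4 * A 0 + 2 * A 1 - (4 * A' 0 + 2 * A' 1) = 0 := by omega
    rw [Finset.sum_eq_add A A' hAA'] at hk0
    · simpa only [Nat.sub_self, hw', pow_zero, mul_one, Polynomial.coeff_C_mul, mul_comm 3 k,
        Polynomial.coeff_expand_mul (show 0 < 3 by norm_num), hRE, Polynomial.coeff_add] using hk0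
    -- Off the face the weight gap is even and positive. To affect `s ^ 0` or `s ^ 3` it would have
    -- to be 0 or 3, so these monomials contribute nothing.
    · intro m hm hmA
      have hle := hmax m hm
      have hlt : 4 * m 0 + 2 * m 1 ≠ 4 * A 0 + 2 * A 1 := fun hw => by
        rcases hface m hm hw with h | h
        · exact hmA.1 h
        · exact hmA.2 h
      rw [Polynomial.coeff_mul_X_pow']
      split_ifs with hc
      · rw [Polynomial.coeff_C_mul, Polynomial.coeff_expand (by norm_num), if_neg (by omega), mul_zero]
      · rfl
    · exact fun h => absurd hA h
    · intro h
      rw [MvPolynomial.notMem_support_iff.mp h]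
      simp
  have hR0 : R.coeff 0 ≠ 0 := by
    simp only [Polynomial.coeff_zero_eq_eval_zero] at hP hQ
    rw [hR, Polynomial.coeff_zero_eq_eval_zero, Polynomial.eval_mul, Polynomial.eval_pow,
      Polynomial.eval_pow]
    exact mul_ne_zero (pow_ne_zero _ hP) (pow_ne_zero _ hQ)
  have k0 : E.coeff 0 = 0 := by
    have := key 0 (by norm_num)
    rw [Polynomial.mul_coeff_zero] at this
    exact (mul_eq_zero.mp this).resolve_left hR0
  have k1 : E.coeff 1 = 0 := by
    have := key 1 le_rfl
    rw [Polynomial.mul_coeff_one, k0, mul_zero, add_zero] at this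
    exact (mul_eq_zero.mp this).resolve_left hR0
  rw [hE, Polynomial.coeff_add, Polynomial.coeff_C_mul, Polynomial.coeff_C_mul, pow_two] at k0 k1
  rw [Polynomial.mul_coeff_zero] at k0
  rw [Polynomial.mul_coeff_one] at k1
  have hFA : F.coeff A ≠ 0 := MvPolynomial.mem_support_iff.mp hA
  have : F.coeff A * Q.coeff 0 * (2 * Q.coeff 1 * P.coeff 0 - Q.coeff 0 * P.coeff 1) = 0 := by
    linear_combination P.coeff 0 * k1 - P.coeff 1 * k0
  exact mul_ne_zero (mul_ne_zero hFA hQ) (sub_ne_zero.mpr hPQ) this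

theorem six_le_totalDegree_of_param (F : MvPolynomial (Fin 2) ℂ) (hF : F ≠ 0) (N : ℕ) (hN : 2 ≤ N)
    (P Q P' Q' : Polynomial ℂ) (hP : P.coeff 0 ≠ 0) (hQ : Q.coeff 0 ≠ 0)
    (hP' : P'.coeff 0 ≠ 0) (hQ' : Q'.coeff 0 ≠ 0)
    (h : ∀ s : ℂ, ‖s‖ = 1 → ∃ Z W : ℂ, s ^ (N + 1) * Z = P.eval s ∧ s ^ (N - 1) * W = Q.eval s ∧
      MvPolynomial.eval ![Z, W] F = 0)
    (h' : ∀ s : ℂ, ‖s‖ = 1 → ∃ Z W : ℂ, s ^ (N - 1) * Z = Q'.eval s ∧ s ^ (N + 1) * W = P'.eval s ∧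
      MvPolynomial.eval ![Z, W] F = 0)
    (h3 : N = 3 → ∃ P₀ Q₀ : Polynomial ℂ, P = Polynomial.expand ℂ 3 P₀ ∧
      Q = Polynomial.expand ℂ 3 Q₀ ∧ 2 * Q₀.coeff 1 * P₀.coeff 0 ≠ Q₀.coeff 0 * P₀.coeff 1) :
    6 ≤ F.totalDegree := by
  have hS : F.support.Nonempty := by simpa [Finset.nonempty_iff_ne_empty] using hF
  have e1 : ∀ s : ℂ, ‖s‖ = 1 → ∃ z : Fin 2 → ℂ,
      (∀ i, s ^ (![N + 1, N - 1] : Fin 2 → ℕ) i * z i = ((![P, Q] : Fin 2 → Polynomial ℂ) i).eval s) ∧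
      MvPolynomial.eval z F = 0 := by
    intro s hs
    obtain ⟨Z, W, hZ, hW, he⟩ := h s hs
    exact ⟨![Z, W], fun i => by fin_cases i <;> simp [hZ, hW], he⟩
  have e2 : ∀ s : ℂ, ‖s‖ = 1 → ∃ z : Fin 2 → ℂ,
      (∀ i, s ^ (![N - 1, N + 1] : Fin 2 → ℕ) i * z i = ((![Q', P'] : Fin 2 → Polynomial ℂ) i).eval s) ∧
      MvPolynomial.eval z F = 0 := by
    intro s hs
    obtain ⟨Z, W, hZ, hW, he⟩ := h' s hs
    exact ⟨![Z, W], fun i => by fin_cases i <;> simp [hZ, hW], he⟩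
  have f1 := exists_ne_mem_face F ![N + 1, N - 1] ![P, Q]
    (fun i => by fin_cases i <;> simp [hP, hQ]) e1
  have f2 := exists_ne_mem_face F ![N - 1, N + 1] ![Q', P']
    (fun i => by fin_cases i <;> simp [hP', hQ']) e2
  simp only [Matrix.cons_val_zero, Matrix.cons_val_one] at f1 f2
  by_cases hN3 : N = 3
  · subst hN3
    obtain ⟨P₀, Q₀, rfl, rfl, hne⟩ := h3 rfl
    obtain ⟨A, hA, hmax, hmax', h0, h1⟩ := exists_vertex_of_faces F.support hS 4 2 2 (by norm_num)
      (fun x y hxy => by omega) f1 f2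
    exact six_le_of_weight_four_two F P₀ Q₀ (by simpa [Polynomial.coeff_expand] using hP)
      (by simpa [Polynomial.coeff_expand] using hQ) hne e1 A hA hmax hmax' h0 h1
  · obtain ⟨d, hd3, hd⟩ := exists_three_le_dvd N hN hN3
    obtain ⟨A, hA, -, -, h0, h1⟩ := exists_vertex_of_faces F.support hS (N + 1) (N - 1) d (by omega)
      hd f1 f2
    have := MvPolynomial.le_totalDegree hA
    rw [Finsupp.sum_fintype _ _ (by simp), Fin.sum_univ_two] at this
    omega

/-! ### The support parametrization in complex coordinates. -/

/-- `α cos θ + β sin θ + Re (∑ k ≤ N, g k * exp (i k θ))`. -/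
noncomputable def trigSupport (α β : ℝ) (g : ℕ → ℂ) (N : ℕ) (θ : ℝ) : ℝ :=
  α * Real.cos θ + β * Real.sin θ +
    (∑ k ∈ Finset.range (N + 1), g k * Complex.exp (k * (θ * Complex.I))).re

/-- `s ^ N (q + i q')` for `q = Re (∑ k ≤ N, g k * s ^ (-k))` and `s = exp (-iθ)`. -/
noncomputable def topNumerator (g : ℕ → ℂ) (N : ℕ) : Polynomial ℂ :=
  ∑ k ∈ Finset.range (N + 1), (Polynomial.C ((1 - k) * g k / 2) * Polynomial.X ^ (N - k) +
    Polynomial.C ((1 + k) * starRingEnd ℂ (g k) / 2) * Polynomial.X ^ (N + k))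

/-- `s ^ N (q - i q')` for `q = Re (∑ k ≤ N, g k * s ^ (-k))` and `s = exp (-iθ)`. -/
noncomputable def botNumerator (g : ℕ → ℂ) (N : ℕ) : Polynomial ℂ :=
  ∑ k ∈ Finset.range (N + 1), (Polynomial.C ((1 + k) * g k / 2) * Polynomial.X ^ (N - k) +
    Polynomial.C ((1 - k) * starRingEnd ℂ (g k) / 2) * Polynomial.X ^ (N + k))

theorem hasDerivAt_trigSupport (α β : ℝ) (g : ℕ → ℂ) (N : ℕ) (θ : ℝ) :
    HasDerivAt (trigSupport α β g N) (-α * Real.sin θ + β * Real.cos θ +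
      (∑ k ∈ Finset.range (N + 1),
        k * Complex.I * g k * Complex.exp (k * (θ * Complex.I))).re) θ := by
  have h1 : HasDerivAt (fun θ : ℝ => ∑ k ∈ Finset.range (N + 1),
      g k * Complex.exp (k * (θ * Complex.I))) (∑ k ∈ Finset.range (N + 1),
        k * Complex.I * g k * Complex.exp (k * (θ * Complex.I))) θ := by
    refine HasDerivAt.fun_sum fun k _ => ?_
    have h := ((((Complex.ofRealCLM.hasDerivAt (x := θ)).mul_const Complex.I).const_mul
      (k : ℂ)).cexp).const_mul (g k)
    refine h.congr_deriv ?_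
    simp only [Complex.ofRealCLM_apply, Complex.ofReal_one]
    ring
  have h2 := (Complex.reCLM.hasFDerivAt.comp_hasDerivAt θ h1)
  have h3 := (((Real.hasDerivAt_cos θ).const_mul α).add ((Real.hasDerivAt_sin θ).const_mul β)).add h2
  refine h3.congr_deriv ?_
  simp only [Complex.reCLM_apply]
  ring

theorem deriv_trigSupport (α β : ℝ) (g : ℕ → ℂ) (N : ℕ) (θ : ℝ) :
    deriv (trigSupport α β g N) θ = -α * Real.sin θ + β * Real.cos θ +
      (∑ k ∈ Finset.range (N + 1),
        k * Complex.I * g k * Complex.exp (k * (θ * Complex.I))).re :=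
  (hasDerivAt_trigSupport α β g N θ).deriv

theorem continuous_supportParam_trigSupport (α β : ℝ) (g : ℕ → ℂ) (N : ℕ) :
    Continuous (supportParam (trigSupport α β g N)) := by
  unfold supportParam
  simp only [deriv_trigSupport]
  unfold trigSupport
  have h : ∀ g' : ℕ → ℂ, Continuous fun θ : ℝ => (∑ k ∈ Finset.range (N + 1),
      g' k * Complex.exp (k * (θ * Complex.I))).re := fun g' => by fun_prop
  have h1 := h g
  have h2 := h (fun k => k * Complex.I * g k)
  refine (PiLp.continuous_toLp 2 _).comp (continuous_pi fun i => ?_)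
  fin_cases i
  · simp only [Fin.zero_eta, Matrix.cons_val_zero]
    fun_prop
  · simp only [Fin.mk_one, Matrix.cons_val_one]
    fun_prop

theorem eval_numerators (g : ℕ → ℂ) (N : ℕ) (θ : ℝ) :
    let q : ℂ := ((∑ k ∈ Finset.range (N + 1), g k * Complex.exp (k * (θ * Complex.I))).re : ℝ)
    let q' : ℂ := ((∑ k ∈ Finset.range (N + 1),
        k * Complex.I * g k * Complex.exp (k * (θ * Complex.I))).re : ℝ)
    let s := Complex.exp (-(θ * Complex.I))
    (topNumerator g N).eval s = s ^ N * (q + Complex.I * q') ∧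
    (botNumerator g N).eval s = s ^ N * (q - Complex.I * q') := by
  intro q q' s
  have hs : ∀ k ∈ Finset.range (N + 1),
      s ^ N * Complex.exp (k * (θ * Complex.I)) = s ^ (N - k) := by
    intro k hk
    rw [← Complex.exp_nat_mul, ← Complex.exp_nat_mul, ← Complex.exp_add,
      Nat.cast_sub (Nat.lt_succ_iff.mp (Finset.mem_range.mp hk))]
    congr 1; ring
  have hs' : ∀ k : ℕ, starRingEnd ℂ (Complex.exp (k * (θ * Complex.I))) = s ^ k := by
    intro k
    rw [← Complex.exp_conj, ← Complex.exp_nat_mul]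
    simp
  have hq : q = ∑ k ∈ Finset.range (N + 1), (g k * Complex.exp (k * (θ * Complex.I)) +
      starRingEnd ℂ (g k) * s ^ k) / 2 := by
    simp only [q, Complex.re_eq_add_conj, map_sum, map_mul, hs', ← Finset.sum_add_distrib,
      Finset.sum_div]
  have hq' : q' = ∑ k ∈ Finset.range (N + 1), (k * Complex.I * g k *
      Complex.exp (k * (θ * Complex.I)) - k * Complex.I * starRingEnd ℂ (g k) * s ^ k) / 2 := by
    simp only [q', Complex.re_eq_add_conj, map_sum, map_mul, hs', ← Finset.sum_add_distrib,
      Finset.sum_div, Complex.conj_I, Complex.conj_natCast]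
    exact Finset.sum_congr rfl fun k _ => by ring
  rw [topNumerator, botNumerator, Polynomial.eval_finsetSum, Polynomial.eval_finsetSum, hq, hq']
  constructor
  · rw [Finset.mul_sum, ← Finset.sum_add_distrib, Finset.mul_sum]
    refine Finset.sum_congr rfl fun k hk => ?_
    simp only [Polynomial.eval_add, Polynomial.eval_mul, Polynomial.eval_C, Polynomial.eval_pow,
      Polynomial.eval_X, ← hs k hk, pow_add]
    linear_combination (-(s ^ N * k * g k * Complex.exp (k * (θ * Complex.I)) / 2) +
      s ^ N * k * starRingEnd ℂ (g k) * s ^ k / 2) * Complex.I_mul_I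
  · rw [Finset.mul_sum, ← Finset.sum_sub_distrib, Finset.mul_sum]
    refine Finset.sum_congr rfl fun k hk => ?_
    simp only [Polynomial.eval_add, Polynomial.eval_mul, Polynomial.eval_C, Polynomial.eval_pow,
      Polynomial.eval_X, ← hs k hk, pow_add]
    linear_combination ((s ^ N * k * g k * Complex.exp (k * (θ * Complex.I)) / 2) -
      s ^ N * k * starRingEnd ℂ (g k) * s ^ k / 2) * Complex.I_mul_I

/-- In complex form `γ = (p + i p') exp (iθ)`, and the first harmonics contribute the constant `α +
i β`. The factor `exp (iθ) = s⁻¹`, or its conjugate `s`, turns `N` into `N + 1` or `N - 1`. -/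
theorem supportParam_trigSupport (α β : ℝ) (g : ℕ → ℂ) (N : ℕ) (hN : 1 ≤ N) (θ : ℝ) :
    let z := supportParam (trigSupport α β g N) θ
    let s := Complex.exp (-(θ * Complex.I))
    s ^ (N + 1) * ((z 0 - α) + Complex.I * (z 1 - β)) = (topNumerator g N).eval s ∧
    s ^ (N - 1) * ((z 0 - α) - Complex.I * (z 1 - β)) = (botNumerator g N).eval s := by
  intro z s
  obtain ⟨h1, h2⟩ := eval_numerators g N θ
  rw [h1, h2]
  have hz0 : z 0 = trigSupport α β g N θ * Real.cos θ -
    deriv (trigSupport α β g N) θ * Real.sin θ := rfl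
  have hz1 : z 1 = trigSupport α β g N θ * Real.sin θ +
    deriv (trigSupport α β g N) θ * Real.cos θ := rfl
  rw [hz0, hz1, deriv_trigSupport, trigSupport]
  generalize (∑ k ∈ Finset.range (N + 1), g k * Complex.exp (k * (θ * Complex.I))).re = q
  generalize (∑ k ∈ Finset.range (N + 1),
        k * Complex.I * g k * Complex.exp (k * (θ * Complex.I))).re = q'
  have hcs : (Complex.cos θ) ^ 2 + (Complex.sin θ) ^ 2 = 1 := by
    rw [add_comm]; exact Complex.sin_sq_add_cos_sq _
  have hs : s = Complex.cos θ - Complex.I * Complex.sin θ := by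
    show Complex.exp _ = _
    rw [← neg_mul, Complex.exp_mul_I, Complex.cos_neg, Complex.sin_neg]; ring
  obtain ⟨M, rfl⟩ := Nat.exists_eq_add_of_le hN
  have e1 : 1 + M + 1 = M + 2 := by ring
  have e2 : 1 + M - 1 = M := by omega
  have e3 : 1 + M = M + 1 := by ring
  rw [e1, e2, e3]
  have hst : s * (Complex.cos θ + Complex.I * Complex.sin θ) = 1 := by
    rw [hs]; linear_combination hcs - (Complex.sin θ) ^ 2 * Complex.I_mul_I
  push_cast
  constructor
  · have : ((α * Complex.cos θ + β * Complex.sin θ + q) * Complex.cos θ -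
        (-α * Complex.sin θ + β * Complex.cos θ + q') * Complex.sin θ - α) +
        Complex.I * ((α * Complex.cos θ + β * Complex.sin θ + q) * Complex.sin θ +
        (-α * Complex.sin θ + β * Complex.cos θ + q') * Complex.cos θ - β) =
        (q + Complex.I * q') * (Complex.cos θ + Complex.I * Complex.sin θ) := by
      linear_combination (α + Complex.I * β) * hcs - q' * Complex.sin θ * Complex.I_mul_I
    rw [this]
    linear_combination s ^ (M + 1) * (q + Complex.I * q') * hst
  · have : ((α * Complex.cos θ + β * Complex.sin θ + q) * Complex.cos θ -
        (-α * Complex.sin θ + β * Complex.cos θ + q') * Complex.sin θ - α) -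
        Complex.I * ((α * Complex.cos θ + β * Complex.sin θ + q) * Complex.sin θ +
        (-α * Complex.sin θ + β * Complex.cos θ + q') * Complex.cos θ - β) =
        (q - Complex.I * q') * s := by
      rw [hs]
      linear_combination (α - Complex.I * β) * hcs - q' * Complex.sin θ * Complex.I_mul_I
    rw [this]
    ring

theorem exists_mem_Icc_exp_eq (s : ℂ) (hs : ‖s‖ = 1) :
    ∃ θ ∈ Set.Icc (-Real.pi) Real.pi, Complex.exp (-((θ : ℝ) * Complex.I)) = s := by
  refine ⟨-s.arg, ⟨neg_le_neg (Complex.arg_le_pi s), by linarith [Complex.neg_pi_lt_arg s]⟩, ?_⟩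
  have := Complex.norm_mul_exp_arg_mul_I s
  rw [hs] at this
  simpa using this

theorem coeff_zero_topNumerator (g : ℕ → ℂ) (N : ℕ) (hN : 1 ≤ N) :
    (topNumerator g N).coeff 0 = (1 - N) * g N / 2 := by
  rw [topNumerator, Polynomial.finsetSum_coeff, Finset.sum_eq_single N]
  · simp [Polynomial.coeff_X_pow, show ¬ (0 = N + N) by omega]
  · intro k hk hne
    have : k < N := by have := Finset.mem_range.mp hk; omega
    simp [Polynomial.coeff_X_pow, show ¬ (0 = N - k) by omega, show ¬ (0 = N + k) by omega]
  · simp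

theorem coeff_zero_botNumerator (g : ℕ → ℂ) (N : ℕ) (hN : 1 ≤ N) :
    (botNumerator g N).coeff 0 = (1 + N) * g N / 2 := by
  rw [botNumerator, Polynomial.finsetSum_coeff, Finset.sum_eq_single N]
  · simp [Polynomial.coeff_X_pow, show ¬ (0 = N + N) by omega]
  · intro k hk hne
    have : k < N := by have := Finset.mem_range.mp hk; omega
    simp [Polynomial.coeff_X_pow, show ¬ (0 = N - k) by omega, show ¬ (0 = N + k) by omega]
  · simp

/-- Substitute `x = α + (Z + W) / 2` and `y = β - i (Z - W) / 2`. -/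
theorem exists_complexification (α β : ℝ) (f : MvPolynomial (Fin 2) ℝ) (hf : f ≠ 0) :
    ∃ F : MvPolynomial (Fin 2) ℂ, F ≠ 0 ∧ F.totalDegree ≤ f.totalDegree ∧
      ∀ z : Fin 2 → ℝ, MvPolynomial.eval ![(z 0 - α) + Complex.I * (z 1 - β),
        (z 0 - α) - Complex.I * (z 1 - β)] F = (MvPolynomial.eval z f : ℝ) := by
  let L : Fin 2 → MvPolynomial (Fin 2) ℂ :=
    ![MvPolynomial.C (1 / 2) * (MvPolynomial.X 0 + MvPolynomial.X 1) + MvPolynomial.C (α : ℂ),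
      MvPolynomial.C (-Complex.I / 2) * (MvPolynomial.X 0 - MvPolynomial.X 1) +
        MvPolynomial.C (β : ℂ)]
  have hev : ∀ z : Fin 2 → ℝ, MvPolynomial.eval ![(z 0 - α) + Complex.I * (z 1 - β),
        (z 0 - α) - Complex.I * (z 1 - β)] (MvPolynomial.aeval L f) =
        (MvPolynomial.eval z f : ℝ) := by
    intro z
    have h1 : ((MvPolynomial.eval z f : ℝ) : ℂ) =
        MvPolynomial.aeval (fun i => (z i : ℂ)) f := by
      have := MvPolynomial.aeval_algebraMap_apply ℂ z f
      simpa [MvPolynomial.coe_aeval_eq_eval, Function.comp_def] using this.symm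
    rw [h1, ← MvPolynomial.coe_aeval_eq_eval, RingHom.coe_coe,
      ← AlgHom.restrictScalars_apply ℝ (MvPolynomial.aeval _ : MvPolynomial (Fin 2) ℂ →ₐ[ℂ] ℂ),
      ← AlgHom.comp_apply, MvPolynomial.comp_aeval]
    congr 2
    funext i
    fin_cases i
    · simp [L]; ring
    · simp [L]
      linear_combination (β - z 1) * Complex.I_mul_I
  refine ⟨MvPolynomial.aeval L f, fun h0 => hf ?_, ?_, hev⟩
  · refine MvPolynomial.funext fun z => ?_
    have := hev z
    rw [h0, map_zero] at this
    rw [map_zero]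
    exact_mod_cast this.symm
  · refine MvPolynomial.totalDegree_aeval_le_of_totalDegree_le_one f L fun i => ?_
    fin_cases i
    · refine (MvPolynomial.totalDegree_add _ _).trans (max_le ?_ (by simp))
      refine (MvPolynomial.totalDegree_mul _ _).trans ?_
      rw [MvPolynomial.totalDegree_C, zero_add]
      exact (MvPolynomial.totalDegree_add _ _).trans (by simp)
    · refine (MvPolynomial.totalDegree_add _ _).trans (max_le ?_ (by simp))
      refine (MvPolynomial.totalDegree_mul _ _).trans ?_
      rw [MvPolynomial.totalDegree_C, zero_add]
      exact (MvPolynomial.totalDegree_sub _ _).trans (by simp)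

theorem numerators_eq_expand_three (g : ℕ → ℂ) (ρ : ℝ) (h0 : g 0 = ρ) (h1 : g 1 = 0) (h2 : g 2 = 0) :
    topNumerator g 3 = Polynomial.expand ℂ 3 (Polynomial.C (-g 3) +
      Polynomial.C (ρ : ℂ) * Polynomial.X +
      Polynomial.C (2 * starRingEnd ℂ (g 3)) * Polynomial.X ^ 2) ∧
    botNumerator g 3 = Polynomial.expand ℂ 3 (Polynomial.C (2 * g 3) +
      Polynomial.C (ρ : ℂ) * Polynomial.X +
      Polynomial.C (-starRingEnd ℂ (g 3)) * Polynomial.X ^ 2) := by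
  have hρ : Polynomial.C (ρ : ℂ) = Polynomial.C ((ρ : ℂ) / 2) + Polynomial.C ((ρ : ℂ) / 2) := by
    rw [← Polynomial.C_add, add_halves]
  have e1 : (1 - 3 : ℂ) * g 3 / 2 = -g 3 := by ring
  have e2 : (1 + 3 : ℂ) * g 3 / 2 = 2 * g 3 := by ring
  have e3 : (1 - 3 : ℂ) * starRingEnd ℂ (g 3) / 2 = -starRingEnd ℂ (g 3) := by ring
  have e4 : (1 + 3 : ℂ) * starRingEnd ℂ (g 3) / 2 = 2 * starRingEnd ℂ (g 3) := by ring
  constructor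
  · simp only [topNumerator, Finset.sum_range_succ, Finset.range_zero, Finset.sum_empty,
      Nat.cast_ofNat, e1, e4, h0, h1, h2, map_zero, Complex.conj_ofReal, map_add,
      map_mul (Polynomial.expand ℂ 3), map_pow (Polynomial.expand ℂ 3), Polynomial.expand_C,
      Polynomial.expand_X, hρ]
    simp
    ring
  · simp only [botNumerator, Finset.sum_range_succ, Finset.range_zero, Finset.sum_empty,
      Nat.cast_ofNat, e2, e3, h0, h1, h2, map_zero, Complex.conj_ofReal, map_add,
      map_mul (Polynomial.expand ℂ 3), map_pow (Polynomial.expand ℂ 3), Polynomial.expand_C,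
      Polynomial.expand_X, hρ]
    simp
    ring

theorem six_le_totalDegree_of_vanish (α β ρ : ℝ) (g : ℕ → ℂ) (N : ℕ) (hN : 2 ≤ N) (hρ : ρ ≠ 0)
    (h0 : g 0 = ρ) (h1 : g 1 = 0) (hgN : g N ≠ 0) (h3 : N = 3 → g 2 = 0)
    (f : MvPolynomial (Fin 2) ℝ) (hf : f ≠ 0)
    (hv : ∀ z ∈ supportCurve (trigSupport α β g N), MvPolynomial.eval (fun i => z i) f = 0) :
    6 ≤ f.totalDegree := by
  obtain ⟨F, hF, hdeg, hev⟩ := exists_complexification α β f hf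
  refine le_trans ?_ hdeg
  have hN1 : (1 - N : ℂ) ≠ 0 := by
    rw [sub_ne_zero]
    exact_mod_cast (show 1 ≠ N by omega)
  have hN2 : (1 + N : ℂ) ≠ 0 := by exact_mod_cast (show 1 + N ≠ 0 by omega)
  have ht : (topNumerator g N).coeff 0 ≠ 0 := by
    rw [coeff_zero_topNumerator g N (by omega)]
    exact div_ne_zero (mul_ne_zero hN1 hgN) two_ne_zero
  have hb : (botNumerator g N).coeff 0 ≠ 0 := by
    rw [coeff_zero_botNumerator g N (by omega)]
    exact div_ne_zero (mul_ne_zero hN2 hgN) two_ne_zero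
  have key : ∀ s : ℂ, ‖s‖ = 1 → ∃ z : Plane,
      s ^ (N + 1) * ((z 0 - α) + Complex.I * (z 1 - β)) = (topNumerator g N).eval s ∧
      s ^ (N - 1) * ((z 0 - α) - Complex.I * (z 1 - β)) = (botNumerator g N).eval s ∧
      MvPolynomial.eval ![(z 0 - α) + Complex.I * (z 1 - β),
        (z 0 - α) - Complex.I * (z 1 - β)] F = 0 := by
    intro s hs
    obtain ⟨θ, hθ, rfl⟩ := exists_mem_Icc_exp_eq s hs
    obtain ⟨e1, e2⟩ := supportParam_trigSupport α β g N (by omega) θ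
    refine ⟨_, e1, e2, ?_⟩
    have := hev (fun i => supportParam (trigSupport α β g N) θ i)
    rw [this, hv _ ⟨θ, hθ, rfl⟩, Complex.ofReal_zero]
  have hconj : ∀ (p : Polynomial ℂ) (s : ℂ),
      (p.map (starRingEnd ℂ)).eval s = starRingEnd ℂ (p.eval (starRingEnd ℂ s)) := by
    intro p s
    rw [← Polynomial.eval_map_apply, Complex.conj_conj]
  refine six_le_totalDegree_of_param F hF N hN (topNumerator g N) (botNumerator g N)
    ((topNumerator g N).map (starRingEnd ℂ)) ((botNumerator g N).map (starRingEnd ℂ)) ht hb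
    (by simpa using ht) (by simpa using hb) ?_ ?_ ?_
  · intro s hs
    obtain ⟨z, e1, e2, e3⟩ := key s hs
    exact ⟨_, _, e1, e2, e3⟩
  -- Conjugating the identities at the conjugate of `s` exchanges `Z` and `W`.
  · intro s hs
    obtain ⟨z, e1, e2, e3⟩ := key (starRingEnd ℂ s) (by simpa using hs)
    refine ⟨_, _, ?_, ?_, e3⟩
    · rw [hconj, ← e2]
      simp
    · rw [hconj, ← e1]
      simp [sub_eq_add_neg]
  · rintro rfl
    obtain ⟨e1, e2⟩ := numerators_eq_expand_three g ρ h0 h1 (h3 rfl)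
    refine ⟨_, _, e1, e2, ?_⟩
    have hc : ∀ a b c : ℂ, (Polynomial.C a + Polynomial.C b * Polynomial.X +
        Polynomial.C c * Polynomial.X ^ 2).coeff 0 = a ∧ (Polynomial.C a +
        Polynomial.C b * Polynomial.X + Polynomial.C c * Polynomial.X ^ 2).coeff 1 = b :=
      fun a b c => by simp [Polynomial.coeff_X_pow, Polynomial.coeff_C]
    rw [(hc _ _ _).1, (hc _ _ _).2, (hc _ _ _).1, (hc _ _ _).2]
    intro h
    have : (4 * ρ : ℂ) * g 3 = 0 := by linear_combination -h
    simp [hρ, hgN] at this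

/-! ### Existence of defining polynomials. -/

theorem MvPolynomial.finSuccEquiv_rename_succ {R : Type*} [CommSemiring R] {n : ℕ}
    (r : MvPolynomial (Fin n) R) :
    MvPolynomial.finSuccEquiv R n (MvPolynomial.rename Fin.succ r) = Polynomial.C r := by
  induction r using MvPolynomial.induction_on with
  | C a => simp [MvPolynomial.finSuccEquiv_apply]
  | add p q hp hq => rw [map_add, map_add, hp, hq, Polynomial.C_add]
  | mul_X p i hp =>
    rw [map_mul, map_mul, hp, MvPolynomial.rename_X, MvPolynomial.finSuccEquiv_X_succ,
      Polynomial.C_mul]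

theorem exists_isDefiningPolynomial_of_param (C : Set Plane) (K : ℕ) (P : Fin 2 → Polynomial ℂ)
    (h₁ : ∀ z ∈ C, ∃ s : ℂ, ‖s‖ = 1 ∧ ∀ i, s ^ K * z i = (P i).eval s)
    (h₂ : ∀ s : ℂ, ‖s‖ = 1 → ∃ z ∈ C, ∀ i, s ^ K * z i = (P i).eval s)
    (hinf : ((fun z : Plane => z 1) '' C).Infinite) : ∃ f, IsDefiningPolynomial f C := by
  let I : Ideal (MvPolynomial (Fin 2) ℝ) :=
    { carrier := {g | ∀ z ∈ C, MvPolynomial.eval (fun i => z i) g = 0}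
      add_mem' := fun {a b} ha hb z hz => by simp [ha z hz, hb z hz]
      zero_mem' := fun z _ => by simp
      smul_mem' := fun c x hx z hz => by simp [hx z hz] }
  have hmem : ∀ g, g ∈ I ↔ ∀ z ∈ C, MvPolynomial.eval (fun i => z i) g = 0 := fun g => Iff.rfl
  have hnorm : ∀ s : ℂ, ‖s‖ = 1 → s ≠ 0 := fun s hs h => by simp [h] at hs
  have hne : C.Nonempty := by
    obtain ⟨z, hz, -⟩ := h₂ 1 (by simp)
    exact ⟨z, hz⟩
  have hprime : I.IsPrime := by
    refine ⟨?_, ?_⟩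
    · rw [Ideal.ne_top_iff_one, hmem]
      obtain ⟨z, hz⟩ := hne
      intro h
      simpa using h z hz
    · intro a b hab
      obtain ⟨M, A, hA⟩ := MvPolynomial.exists_numerator K P a
      obtain ⟨M', B, hB⟩ := MvPolynomial.exists_numerator K P b
      -- Primality comes from `ℂ[s]` being a domain: the numerators multiply to zero on the whole
      -- circle.
      have hAB : A * B = 0 := by
        refine Polynomial.eq_zero_of_forall_norm_eq_one _ fun s hs => ?_
        obtain ⟨z, hz, hzs⟩ := h₂ s hs
        have h := hab z hz
        rw [map_mul] at h
        rw [Polynomial.eval_mul, ← hA s _ hzs, ← hB s _ hzs]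
        have h' : ((MvPolynomial.eval (fun i => z i) a : ℝ) : ℂ) *
          (MvPolynomial.eval (fun i => z i) b : ℝ) = 0 := by exact_mod_cast h
        linear_combination s ^ M * s ^ M' * h'
      have aux : ∀ (c : MvPolynomial (Fin 2) ℝ) (M : ℕ),
          (∀ (s : ℂ) (z : Fin 2 → ℝ), (∀ i, s ^ K * z i = (P i).eval s) →
            s ^ M * (MvPolynomial.eval z c : ℝ) = (0 : Polynomial ℂ).eval s) → c ∈ I := by
        intro c M h z hz
        obtain ⟨s, hs, hzs⟩ := h₁ z hz
        have := h s _ hzs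
        rw [Polynomial.eval_zero] at this
        exact_mod_cast (mul_eq_zero.mp this).resolve_left (pow_ne_zero _ (hnorm s hs))
      rcases mul_eq_zero.mp hAB with rfl | rfl
      · exact Or.inl (aux a M hA)
      · exact Or.inr (aux b M' hB)
  let e := MvPolynomial.finSuccEquiv ℝ 1
  let J : Ideal (Polynomial (MvPolynomial (Fin 1) ℝ)) := I.comap (e.symm : _ →+* _)
  have hJ : ∀ q, q ∈ J ↔ e.symm q ∈ I := fun q => Iff.rfl
  have hJp : J.IsPrime := Ideal.comap_isPrime _ _
  obtain ⟨f, hf, hfJ⟩ := Polynomial.exists_irreducible_forall_mem_iff_dvd J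
    (by
      obtain ⟨h, h0, hh⟩ := exists_ne_zero_algebraic_relation K P
      refine ⟨e h, ?_, by simpa using h0⟩
      rw [hJ, AlgEquiv.symm_apply_apply, hmem]
      intro z hz
      obtain ⟨s, hs, hzs⟩ := h₁ z hz
      exact hh s _ (hnorm s hs) hzs)
    (by
      intro r hr
      refine MvPolynomial.funext_set (fun _ => (fun z : Plane => z 1) '' C) (fun _ => hinf) ?_
      intro x hx
      obtain ⟨z, hz, hzx⟩ := hx 0 trivial
      have h := (hmem _).mp ((hJ _).mp hr) z hz
      have hr' : e.symm (Polynomial.C r) = MvPolynomial.rename Fin.succ r := by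
        rw [AlgEquiv.symm_apply_eq, MvPolynomial.finSuccEquiv_rename_succ]
      rw [hr', MvPolynomial.eval_rename] at h
      rw [map_zero, ← h]
      congr 2
      funext i
      rw [Subsingleton.elim i 0]
      exact hzx.symm)
  refine ⟨e.symm f, (MulEquiv.irreducible_iff e.symm).mpr hf, fun g => ?_⟩
  rw [← hmem, ← AlgEquiv.symm_apply_apply e g, ← hJ, hfJ, map_dvd_iff]

theorem exists_isDefiningPolynomial_trigSupport (α β ρ : ℝ) (g : ℕ → ℂ) (N : ℕ) (hN : 2 ≤ N)
    (hρ : ρ ≠ 0) (h0 : g 0 = ρ) (h1 : g 1 = 0) (hgN : g N ≠ 0) (h3 : N = 3 → g 2 = 0) :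
    ∃ f, IsDefiningPolynomial f (supportCurve (trigSupport α β g N)) := by
  set C := supportCurve (trigSupport α β g N) with hC
  let P : Fin 2 → Polynomial ℂ :=
    ![Polynomial.C (α : ℂ) * Polynomial.X ^ (N + 1) +
        Polynomial.C (1 / 2) * (topNumerator g N + Polynomial.X ^ 2 * botNumerator g N),
      Polynomial.C (β : ℂ) * Polynomial.X ^ (N + 1) +
        Polynomial.C (-Complex.I / 2) * (topNumerator g N - Polynomial.X ^ 2 * botNumerator g N)]
  have hP : ∀ θ : ℝ, ∀ i, Complex.exp (-(θ * Complex.I)) ^ (N + 1) *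
      supportParam (trigSupport α β g N) θ i = (P i).eval (Complex.exp (-(θ * Complex.I))) := by
    intro θ i
    obtain ⟨e1, e2⟩ := supportParam_trigSupport α β g N (by omega) θ
    have e3 : Complex.exp (-(θ * Complex.I)) ^ (N + 1) =
        Complex.exp (-(θ * Complex.I)) ^ 2 * Complex.exp (-(θ * Complex.I)) ^ (N - 1) := by
      rw [← pow_add]; congr 1; omega
    fin_cases i
    · simp [P]
      rw [← e1, ← e2, e3]
      ring
    · simp [P]
      rw [← e1, ← e2, e3]
      linear_combination -Complex.exp (-(θ * Complex.I)) ^ 2 *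
        Complex.exp (-(θ * Complex.I)) ^ (N - 1) *
        (β - supportParam (trigSupport α β g N) θ 1) * Complex.I_mul_I
  refine exists_isDefiningPolynomial_of_param C (N + 1) P ?_ ?_ ?_
  · rintro z ⟨θ, -, rfl⟩
    exact ⟨_, by rw [Complex.norm_exp]; simp, hP θ⟩
  · intro s hs
    obtain ⟨θ, hθ, rfl⟩ := exists_mem_Icc_exp_eq s hs
    exact ⟨_, ⟨θ, hθ, rfl⟩, hP θ⟩
  -- The projection to the `y`-axis is connected. Were it a point, the curve would lie on a line,
  -- against the bound 6.
  · have hconn : IsPreconnected ((fun z : Plane => z 1) '' C) := by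
      refine IsPreconnected.image ?_ _ (by fun_prop)
      exact isPreconnected_Icc.image _ (continuous_supportParam_trigSupport α β g N).continuousOn
    refine hconn.infinite_of_nontrivial ?_
    by_contra hnt
    rw [Set.not_nontrivial_iff] at hnt
    have hpi : (0 : ℝ) ∈ Set.Icc (-Real.pi) Real.pi :=
      ⟨by linarith [Real.pi_pos], Real.pi_pos.le⟩
    set c := supportParam (trigSupport α β g N) 0 1 with hc
    have := six_le_totalDegree_of_vanish α β ρ g N hN hρ h0 h1 hgN h3
      (MvPolynomial.X 1 - MvPolynomial.C c) (fun h => by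
        have := congrArg (MvPolynomial.eval fun _ => c + 1) h
        simp at this) (fun z hz => by
        have := hnt ⟨z, hz, rfl⟩ ⟨_, ⟨0, hpi, rfl⟩, rfl⟩
        simp only at this
        simp [this, hc])
    have h5 := MvPolynomial.totalDegree_sub_C_le (MvPolynomial.X (R := ℝ) (1 : Fin 2)) c
    rw [MvPolynomial.totalDegree_X] at h5
    omega

/-! ### Reduction of rotors to the normal form; circles. -/

theorem rotorSupport_eq_trigSupport (n : ℕ) (hn : 3 ≤ n) (ρ : ℝ) (m : ℕ) (a b : ℤ → ℝ) :
    ∃ (α β : ℝ) (g : ℕ → ℂ) (N : ℕ), rotorSupport n ρ m a b = trigSupport α β g N ∧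
      g 0 = ρ ∧ g 1 = 0 ∧ (N = 3 → g 2 = 0) ∧ (N = 0 ∨ 2 ≤ N ∧ g N ≠ 0) := by
  -- The terms with `k = 0` have frequencies `1` and `-1`; they go into `α` and `β`, so `G` starts
  -- at `k = 1`.
  set G : Polynomial ℂ := Polynomial.C (ρ : ℂ) + ∑ k ∈ Finset.range m,
    (Polynomial.C (a ((k + 1 : ℕ) * n + 1) - b ((k + 1 : ℕ) * n + 1) * Complex.I : ℂ) *
        Polynomial.X ^ ((k + 1) * n + 1) +
      Polynomial.C (a ((k + 1 : ℕ) * n - 1) - b ((k + 1 : ℕ) * n - 1) * Complex.I : ℂ) *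
        Polynomial.X ^ ((k + 1) * n - 1)) with hG
  have hcoeff : ∀ j, 0 < j → (∀ k < m, j ≠ (k + 1) * n + 1 ∧ j ≠ (k + 1) * n - 1) →
      G.coeff j = 0 := by
    intro j hj h
    rw [hG, Polynomial.coeff_add, Polynomial.coeff_C, if_neg (by omega), zero_add,
      Polynomial.finsetSum_coeff]
    refine Finset.sum_eq_zero fun k hk => ?_
    obtain ⟨h1, h2⟩ := h k (Finset.mem_range.mp hk)
    rw [Polynomial.coeff_add, Polynomial.coeff_C_mul, Polynomial.coeff_C_mul,
      Polynomial.coeff_X_pow, Polynomial.coeff_X_pow, if_neg h1, if_neg h2]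
    simp
  have hkn : ∀ k : ℕ, n ≤ (k + 1) * n := fun k => Nat.le_mul_of_pos_left n (by omega)
  have h0 : G.coeff 0 = ρ := by
    rw [hG, Polynomial.coeff_add, Polynomial.coeff_C_zero, Polynomial.finsetSum_coeff,
      Finset.sum_eq_zero, add_zero]
    intro k _
    have := hkn k
    rw [Polynomial.coeff_add, Polynomial.coeff_C_mul, Polynomial.coeff_C_mul,
      Polynomial.coeff_X_pow, Polynomial.coeff_X_pow, if_neg (by omega), if_neg (by omega)]
    simp
  have h1 : G.coeff 1 = 0 := hcoeff 1 (by norm_num) fun k _ => by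
    have := hkn k
    omega
  refine ⟨a 1 + a (-1), b 1 - b (-1), G.coeff, G.natDegree, ?_, h0, h1, ?_, ?_⟩
  · funext θ
    have hmono : ∀ (x y : ℝ) (j : ℕ), ((x - y * Complex.I : ℂ) *
        Complex.exp (θ * Complex.I) ^ j).re = x * Real.cos (j * θ) + y * Real.sin (j * θ) := by
      intro x y j
      have : Complex.exp (θ * Complex.I) ^ j =
          Real.cos (j * θ) + Real.sin (j * θ) * Complex.I := by
        rw [← Complex.exp_nat_mul, ← mul_assoc, Complex.exp_mul_I]
        push_cast
        rfl
      rw [this]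
      simp [-Complex.ofReal_cos, -Complex.ofReal_sin]
    have hE : (∑ k ∈ Finset.range (G.natDegree + 1), G.coeff k *
        Complex.exp (k * (θ * Complex.I))) = G.eval (Complex.exp (θ * Complex.I)) := by
      rw [Polynomial.eval_eq_sum_range]
      simp only [← Complex.exp_nat_mul]
    rw [trigSupport, hE, hG, rotorSupport, Finset.sum_range_succ', Polynomial.eval_add,
      Polynomial.eval_finsetSum, Complex.add_re, Complex.re_sum]
    simp only [Polynomial.eval_add, Polynomial.eval_mul, Polynomial.eval_C, Polynomial.eval_pow,
      Polynomial.eval_X, Complex.add_re, hmono, Complex.ofReal_re]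
    have hs : ∀ k : ℕ, (((k + 1) * n - 1 : ℕ) : ℝ) = ((k + 1 : ℕ) : ℝ) * n - 1 := by
      intro k
      rw [Nat.cast_sub ((hkn k).trans' (by omega))]
      push_cast
      rfl
    have hs' : ∀ k : ℕ, (((k + 1) * n + 1 : ℕ) : ℝ) = ((k + 1 : ℕ) : ℝ) * n + 1 := by
      intro k
      push_cast
      rfl
    simp only [hs, hs', Nat.cast_zero, zero_mul, zero_add, zero_sub, neg_mul, one_mul, Real.cos_neg,
      Real.sin_neg, ← add_assoc]
    ring
  -- A second harmonic forces `n = 3`, and then no frequency is a multiple of 3, so the top one is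
  -- not 3.
  · intro h3
    refine hcoeff 2 (by norm_num) fun k hk => ?_
    by_contra hcon
    have hk2 : 2 = (k + 1) * n - 1 := by
      have := hkn k
      omega
    have hk3 : (k + 1) * n = 3 := by omega
    have hn3 : n = 3 := by
      have := hkn k
      omega
    have : G.coeff 3 = 0 := hcoeff 3 (by norm_num) fun k' _ => by
      subst hn3
      omega
    rw [← h3, Polynomial.coeff_natDegree, Polynomial.leadingCoeff_eq_zero] at this
    simp [this] at h3
  · by_cases hN : G.natDegree = 0
    · exact Or.inl hN
    · have hne : G.coeff G.natDegree ≠ 0 := by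
        rw [Polynomial.coeff_natDegree, Ne, Polynomial.leadingCoeff_eq_zero]
        rintro h
        simp [h] at hN
      refine Or.inr ⟨?_, hne⟩
      by_contra! hlt
      have : G.natDegree = 1 := by omega
      exact hne (by rw [this, h1])

theorem mem_sphere_plane (c z : Plane) (r : ℝ) (hr : 0 ≤ r) :
    z ∈ Metric.sphere c r ↔ (z 0 - c 0) ^ 2 + (z 1 - c 1) ^ 2 = r ^ 2 := by
  rw [Metric.mem_sphere, EuclideanSpace.dist_eq, Fin.sum_univ_two, Real.dist_eq, Real.dist_eq,
    sq_abs, sq_abs, Real.sqrt_eq_iff_eq_sq (by positivity) hr]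

theorem isCircle_trigSupport_zero (α β ρ : ℝ) (hρ : 0 < ρ) (g : ℕ → ℂ) (h0 : g 0 = ρ) :
    IsCircle (supportCurve (trigSupport α β g 0)) := by
  refine ⟨!₂[α, β], ρ, hρ, ?_⟩
  have hp : ∀ θ, supportParam (trigSupport α β g 0) θ =
      !₂[α + ρ * Real.cos θ, β + ρ * Real.sin θ] := by
    intro θ
    rw [supportParam, deriv_trigSupport, trigSupport]
    have := Real.sin_sq_add_cos_sq θ
    simp [h0, -Complex.ofReal_cos, -Complex.ofReal_sin]
    constructor
    · linear_combination α * this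
    · linear_combination β * this
  ext z
  rw [mem_sphere_plane _ _ _ hρ.le]
  constructor
  · rintro ⟨θ, -, rfl⟩
    rw [hp]
    simp
    linear_combination ρ ^ 2 * Real.sin_sq_add_cos_sq θ
  · intro hz
    simp at hz
    set w : ℂ := ⟨(z 0 - α) / ρ, (z 1 - β) / ρ⟩ with hw
    have hwn : ‖w‖ = 1 := by
      rw [Complex.norm_eq_sqrt_sq_add_sq, Real.sqrt_eq_one]
      simp only [hw]
      field_simp
      linarith
    have h1 := Complex.norm_mul_cos_arg w
    have h2 := Complex.norm_mul_sin_arg w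
    rw [hwn, one_mul] at h1 h2
    refine ⟨w.arg, ⟨(Complex.neg_pi_lt_arg w).le, Complex.arg_le_pi w⟩, ?_⟩
    rw [hp, h1, h2]
    ext i
    fin_cases i
    · simp [hw]; field_simp; ring
    · simp [hw]; field_simp; ring

theorem exists_trigSupport_of_mem_algebraicRotors (C : Set Plane) (hC : C ∈ algebraicRotors)
    (hcirc : ¬ IsCircle C) : ∃ (α β ρ : ℝ) (g : ℕ → ℂ) (N : ℕ), 2 ≤ N ∧ ρ ≠ 0 ∧ g 0 = ρ ∧ g 1 = 0 ∧
      g N ≠ 0 ∧ (N = 3 → g 2 = 0) ∧ C = supportCurve (trigSupport α β g N) := by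
  obtain ⟨n, ρ, hn, hρ, m, a, b, -, rfl⟩ := hC
  obtain ⟨α, β, g, N, hp, h0, h1, h3, hN⟩ := rotorSupport_eq_trigSupport n hn ρ m a b
  rw [hp] at hcirc ⊢
  rcases hN with rfl | ⟨hN, hgN⟩
  · exact absurd (isCircle_trigSupport_zero α β ρ hρ g h0) hcirc
  · exact ⟨α, β, ρ, g, N, hN, hρ.ne', h0, h1, hgN, h3, rfl⟩

/-! ### The family with second harmonics, and its sextic. -/

theorem quadraticSupport_eq_trigSupport (a₁ b₁ a₂ b₂ : ℝ) :
    quadraticSupport a₁ b₁ a₂ b₂ = trigSupport a₁ b₁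
      (fun k => if k = 0 then ((1 / 2 : ℝ) : ℂ) else if k = 2 then a₂ - b₂ * Complex.I else 0) 2 := by
  funext θ
  have h2 : Complex.exp (((2 : ℕ) : ℂ) * (θ * Complex.I)) =
      Real.cos (2 * θ) + Real.sin (2 * θ) * Complex.I := by
    rw [← mul_assoc, Complex.exp_mul_I]
    push_cast
    rfl
  rw [trigSupport, Finset.sum_range_succ, Finset.sum_range_succ, Finset.sum_range_one, h2,
    quadraticSupport]
  simp [-Complex.ofReal_cos, -Complex.ofReal_sin]
  ring

theorem hasDerivAt_quadraticSupport (a₁ b₁ a₂ b₂ θ : ℝ) :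
    HasDerivAt (quadraticSupport a₁ b₁ a₂ b₂) (-a₁ * Real.sin θ + b₁ * Real.cos θ -
      2 * a₂ * Real.sin (2 * θ) + 2 * b₂ * Real.cos (2 * θ)) θ := by
  have hid := (hasDerivAt_id θ).const_mul 2
  have h := (((((hasDerivAt_const θ (1 / 2 : ℝ)).add ((Real.hasDerivAt_cos θ).const_mul a₁)).add
    ((Real.hasDerivAt_sin θ).const_mul b₁)).add (hid.cos.const_mul a₂)).add
    (hid.sin.const_mul b₂))
  refine h.congr_deriv ?_
  simp only [id]
  ring

theorem deriv_deriv_quadraticSupport (a₁ b₁ a₂ b₂ θ : ℝ) :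
    deriv (deriv (quadraticSupport a₁ b₁ a₂ b₂)) θ = -a₁ * Real.cos θ - b₁ * Real.sin θ -
      4 * a₂ * Real.cos (2 * θ) - 4 * b₂ * Real.sin (2 * θ) := by
  have he : deriv (quadraticSupport a₁ b₁ a₂ b₂) = fun θ => -a₁ * Real.sin θ + b₁ * Real.cos θ -
      2 * a₂ * Real.sin (2 * θ) + 2 * b₂ * Real.cos (2 * θ) :=
    funext fun θ => (hasDerivAt_quadraticSupport a₁ b₁ a₂ b₂ θ).deriv
  rw [he]
  have hid := (hasDerivAt_id θ).const_mul 2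
  have h := (((((Real.hasDerivAt_sin θ).const_mul (-a₁)).add
    ((Real.hasDerivAt_cos θ).const_mul b₁)).sub (hid.sin.const_mul (2 * a₂))).add
    (hid.cos.const_mul (2 * b₂)))
  refine (h.congr_deriv ?_).deriv
  simp only [id]
  ring

/-- Here `p + p'' = 1 / 2 - 3 (a₂ cos 2θ + b₂ sin 2θ)`. -/
theorem convexityConstraint_quadraticSupport (a₁ b₁ a₂ b₂ : ℝ) (h : |a₂| + |b₂| ≤ 1 / 6) :
    ConvexityConstraint (quadraticSupport a₁ b₁ a₂ b₂) := by
  intro θ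
  rw [deriv_deriv_quadraticSupport, quadraticSupport]
  have h1 : a₂ * Real.cos (2 * θ) ≤ |a₂| := by
    refine (le_abs_self _).trans ?_
    rw [abs_mul]
    exact mul_le_of_le_one_right (abs_nonneg _) (Real.abs_cos_le_one _)
  have h2 : b₂ * Real.sin (2 * θ) ≤ |b₂| := by
    refine (le_abs_self _).trans ?_
    rw [abs_mul]
    exact mul_le_of_le_one_right (abs_nonneg _) (Real.abs_sin_le_one _)
  linarith

theorem quadraticSupport_eq_rotorSupport (a₁ b₁ a₂ b₂ : ℝ) :
    quadraticSupport a₁ b₁ a₂ b₂ = rotorSupport 3 (1 / 2) 1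
      (fun j => if j = 1 then a₁ else if j = 2 then a₂ else 0)
      (fun j => if j = 1 then b₁ else if j = 2 then b₂ else 0) := by
  funext θ
  rw [rotorSupport, Finset.sum_range_succ, Finset.sum_range_one, quadraticSupport]
  norm_num
  ring

/-- Let `t = a₂ cos 2θ + b₂ sin 2θ - 1 / 2`. On the curve the quadratic polynomials `A` and `B`
equal `3t² + 2t` and `t³ + t² / 2`. Hence `E = 2 (3t + 1)²` and `D = t * E`, and substituting `t = D
/ E` in `A = 3t² + 2t` and clearing denominators gives the sextic. -/
theorem exists_sextic_of_quadraticSupport (a₁ b₁ a₂ b₂ : ℝ) :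
    ∃ f : MvPolynomial (Fin 2) ℝ, f ≠ 0 ∧ f.totalDegree ≤ 6 ∧
      ∀ z ∈ supportCurve (quadraticSupport a₁ b₁ a₂ b₂),
        MvPolynomial.eval (fun i => z i) f = 0 := by
  let X : MvPolynomial (Fin 2) ℝ := MvPolynomial.X 0 - MvPolynomial.C a₁
  let Y : MvPolynomial (Fin 2) ℝ := MvPolynomial.X 1 - MvPolynomial.C b₁
  have hX : X.totalDegree ≤ 1 := (MvPolynomial.totalDegree_sub_C_le _ _).trans (by simp)
  have hY : Y.totalDegree ≤ 1 := (MvPolynomial.totalDegree_sub_C_le _ _).trans (by simp)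
  have hmul : ∀ {p q : MvPolynomial (Fin 2) ℝ} {d e : ℕ}, p.totalDegree ≤ d → q.totalDegree ≤ e →
      (p * q).totalDegree ≤ d + e := fun hp hq =>
    (MvPolynomial.totalDegree_mul _ _).trans (add_le_add hp hq)
  have hadd : ∀ {p q : MvPolynomial (Fin 2) ℝ} {d : ℕ}, p.totalDegree ≤ d → q.totalDegree ≤ d →
      (p + q).totalDegree ≤ d := fun hp hq =>
    (MvPolynomial.totalDegree_add _ _).trans (max_le hp hq)
  have hC : ∀ (c : ℝ) (d : ℕ), (MvPolynomial.C c : MvPolynomial (Fin 2) ℝ).totalDegree ≤ d :=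
    fun c d => by simp
  let A : MvPolynomial (Fin 2) ℝ := MvPolynomial.C (4 * (a₂ ^ 2 + b₂ ^ 2)) +
    MvPolynomial.C (-1) * (X * X + Y * Y)
  let B : MvPolynomial (Fin 2) ℝ := MvPolynomial.C a₂ * (X * X + MvPolynomial.C (-1) * (Y * Y)) +
    MvPolynomial.C (2 * b₂) * (X * Y) + MvPolynomial.C (-2 * (a₂ ^ 2 + b₂ ^ 2))
  have hA : A.totalDegree ≤ 2 :=
    hadd (hC _ _) (hmul (d := 0) (hC _ _) (hadd (hmul hX hX) (hmul hY hY)))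
  have hB : B.totalDegree ≤ 2 :=
    hadd (hadd (hmul (d := 0) (hC _ _) (hadd (hmul hX hX) (hmul (d := 0) (hC _ _) (hmul hY hY))))
      (hmul (d := 0) (hC _ _) (hmul hX hY))) (hC _ _)
  let D : MvPolynomial (Fin 2) ℝ := MvPolynomial.C 18 * B + A
  let E : MvPolynomial (Fin 2) ℝ := MvPolynomial.C 6 * A + MvPolynomial.C 2
  have hD : D.totalDegree ≤ 2 := hadd (hmul (d := 0) (hC _ _) hB) hA
  have hE : E.totalDegree ≤ 2 := hadd (hmul (d := 0) (hC _ _) hA) (hC _ _)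
  have hev : ∀ z : Fin 2 → ℝ, MvPolynomial.eval z (MvPolynomial.C 3 * (D * D) +
      MvPolynomial.C 2 * (D * E) + MvPolynomial.C (-1) * (A * (E * E))) =
      (fun A B => 3 * (18 * B + A) ^ 2 + 2 * (18 * B + A) * (6 * A + 2) - A * (6 * A + 2) ^ 2)
        (4 * (a₂ ^ 2 + b₂ ^ 2) - ((z 0 - a₁) ^ 2 + (z 1 - b₁) ^ 2))
        (a₂ * ((z 0 - a₁) ^ 2 - (z 1 - b₁) ^ 2) + 2 * b₂ * ((z 0 - a₁) * (z 1 - b₁)) -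
          2 * (a₂ ^ 2 + b₂ ^ 2)) := by
    intro z
    simp only [D, E, A, B, X, Y, map_add, map_mul, map_sub, MvPolynomial.eval_C,
      MvPolynomial.eval_X]
    ring
  refine ⟨MvPolynomial.C 3 * (D * D) + MvPolynomial.C 2 * (D * E) +
      MvPolynomial.C (-1) * (A * (E * E)), fun h0 => ?_, ?_,
    fun z hz => (hev fun i => z i).trans ?_⟩
  · have h := fun x : ℝ => (hev ![a₁ + x, b₁]).symm.trans
      ((congrArg (MvPolynomial.eval _) h0).trans (map_zero _))
    simp only [Matrix.cons_val_zero, Matrix.cons_val_one, add_sub_cancel_left, sub_self] at h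
    -- On the line `y = b₁` the sextic is a cubic in `x²` with leading coefficient 36; the weights
    -- form its divided difference at `x² = 0, 1, 4, 9`.
    have : (36 : ℝ) = 0 := by
      linear_combination -(h 0) / 36 + h 1 / 24 - h 2 / 60 + h 3 / 360
    norm_num at this
  · exact hadd (hadd ((hmul (d := 0) (hC _ _) (hmul hD hD)).trans (by norm_num))
      ((hmul (d := 0) (hC _ _) (hmul hD hE)).trans (by norm_num)))
      ((hmul (d := 0) (hC _ _) (hmul hA (hmul hE hE))).trans (by norm_num))
  · obtain ⟨θ, -, rfl⟩ := hz
    set c := Real.cos θ with hc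
    set s := Real.sin θ with hs
    have hcs : s ^ 2 + c ^ 2 = 1 := Real.sin_sq_add_cos_sq θ
    set c' := Real.cos (2 * θ) with hc'
    set s' := Real.sin (2 * θ) with hs'
    have hcs' : s' ^ 2 + c' ^ 2 = 1 := Real.sin_sq_add_cos_sq (2 * θ)
    have e1 : c' = c ^ 2 - s ^ 2 := by rw [hc', Real.cos_two_mul']
    have e2 : s' = 2 * s * c := Real.sin_two_mul θ
    -- Apart from the first harmonics, `p = 1 / 2 + u` and `p' = 2 * v`.
    set u := a₂ * c' + b₂ * s' with hu
    set v := -a₂ * s' + b₂ * c' with hv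
    have huv : u ^ 2 + v ^ 2 = a₂ ^ 2 + b₂ ^ 2 := by
      rw [hu, hv]; linear_combination (a₂ ^ 2 + b₂ ^ 2) * hcs'
    have hx : supportParam (quadraticSupport a₁ b₁ a₂ b₂) θ 0 - a₁ =
        (1 / 2 + u) * c - 2 * v * s := by
      rw [supportParam, (hasDerivAt_quadraticSupport a₁ b₁ a₂ b₂ θ).deriv]
      simp only [quadraticSupport, ← hc, ← hs, ← hc', ← hs', hu, hv]
      show _ - a₁ = _
      simp
      linear_combination a₁ * hcs
    have hy : supportParam (quadraticSupport a₁ b₁ a₂ b₂) θ 1 - b₁ =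
        (1 / 2 + u) * s + 2 * v * c := by
      rw [supportParam, (hasDerivAt_quadraticSupport a₁ b₁ a₂ b₂ θ).deriv]
      simp only [quadraticSupport, ← hc, ← hs, ← hc', ← hs', hu, hv]
      simp
      linear_combination b₁ * hcs
    have hAu : 4 * (a₂ ^ 2 + b₂ ^ 2) - (((1 / 2 + u) * c - 2 * v * s) ^ 2 +
        ((1 / 2 + u) * s + 2 * v * c) ^ 2) = 3 * (u - 1 / 2) ^ 2 + 2 * (u - 1 / 2) := by
      linear_combination -((1 / 2 + u) ^ 2 + 4 * v ^ 2) * hcs - 4 * huv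
    have ha : a₂ * c' + b₂ * s' = u := rfl
    have hBu : a₂ * (((1 / 2 + u) * c - 2 * v * s) ^ 2 - ((1 / 2 + u) * s + 2 * v * c) ^ 2) +
        2 * b₂ * (((1 / 2 + u) * c - 2 * v * s) * ((1 / 2 + u) * s + 2 * v * c)) -
          2 * (a₂ ^ 2 + b₂ ^ 2) = (u - 1 / 2) ^ 3 + (u - 1 / 2) ^ 2 / 2 := by
      have e3 : ((1 / 2 + u) * c - 2 * v * s) ^ 2 - ((1 / 2 + u) * s + 2 * v * c) ^ 2 =
          ((1 / 2 + u) ^ 2 - 4 * v ^ 2) * c' - 4 * (1 / 2 + u) * v * s' := by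
        rw [e1, e2]; ring
      have e4 : 2 * (((1 / 2 + u) * c - 2 * v * s) * ((1 / 2 + u) * s + 2 * v * c)) =
          ((1 / 2 + u) ^ 2 - 4 * v ^ 2) * s' + 4 * (1 / 2 + u) * v * c' := by
        rw [e1, e2]; ring
      have e5 : u * (((1 / 2 + u) ^ 2 - 4 * v ^ 2)) + v * (4 * (1 / 2 + u) * v) -
          2 * (u ^ 2 + v ^ 2) = (u - 1 / 2) ^ 3 + (u - 1 / 2) ^ 2 / 2 := by
        ring
      rw [e3, ← e5, huv]
      linear_combination b₂ * e4 + ((1 / 2 + u) ^ 2 - 4 * v ^ 2) * ha -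
        (4 * (1 / 2 + u) * v) * hv
    rw [hx, hy, hAu, hBu]
    ring

/-- A circle satisfies an equation of degree 2. -/
theorem not_isCircle_of_six_le {C : Set Plane}
    (h : ∀ f : MvPolynomial (Fin 2) ℝ, f ≠ 0 → (∀ z ∈ C, MvPolynomial.eval (fun i => z i) f = 0) →
      6 ≤ f.totalDegree) : ¬ IsCircle C := by
  rintro ⟨c, r, hr, rfl⟩
  have h2 : ∀ i, ((MvPolynomial.X i - MvPolynomial.C (c i) : MvPolynomial (Fin 2) ℝ) ^ 2).totalDegree
      ≤ 2 := fun i => by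
    refine (MvPolynomial.totalDegree_pow _ _).trans ?_
    have := MvPolynomial.totalDegree_sub_C_le (MvPolynomial.X (R := ℝ) i) (c i)
    rw [MvPolynomial.totalDegree_X] at this
    omega
  have hle := (MvPolynomial.totalDegree_sub_C_le _ (r ^ 2)).trans
    ((MvPolynomial.totalDegree_add _ _).trans (max_le (h2 0) (h2 1)))
  have := h ((MvPolynomial.X 0 - MvPolynomial.C (c 0)) ^ 2 +
      (MvPolynomial.X 1 - MvPolynomial.C (c 1)) ^ 2 - MvPolynomial.C (r ^ 2)) (fun h0 => by
    have := congrArg (MvPolynomial.eval fun i => c i) h0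
    simp [hr.ne'] at this) (fun z hz => by
    rw [mem_sphere_plane _ _ _ hr.le] at hz
    simp [hz])
  exact absurd (this.trans hle) (by norm_num)

theorem quadraticSupport_sextic (a₁ b₁ a₂ b₂ : ℝ) (h : a₂ ≠ 0 ∨ b₂ ≠ 0)
    (hconv : ConvexityConstraint (quadraticSupport a₁ b₁ a₂ b₂)) :
    IsAlgebraicRotor 3 (1 / 2) (supportCurve (quadraticSupport a₁ b₁ a₂ b₂)) ∧
      ¬ IsCircle (supportCurve (quadraticSupport a₁ b₁ a₂ b₂)) ∧
      ∃ f, IsDefiningPolynomial f (supportCurve (quadraticSupport a₁ b₁ a₂ b₂)) ∧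
        f.totalDegree = 6 := by
  have hg : (a₂ - b₂ * Complex.I : ℂ) ≠ 0 := by
    intro h0
    have h1 := congrArg Complex.re h0
    have h2 := congrArg Complex.im h0
    simp at h1 h2
    exact h.elim (fun h => h h1) (fun h => h h2)
  have hsix := six_le_totalDegree_of_vanish a₁ b₁ (1 / 2)
    (fun k => if k = 0 then ((1 / 2 : ℝ) : ℂ) else if k = 2 then a₂ - b₂ * Complex.I else 0) 2
    le_rfl (by norm_num) (by simp) (by simp) (by simpa using hg) (by norm_num)
  obtain ⟨f, hf⟩ := exists_isDefiningPolynomial_trigSupport a₁ b₁ (1 / 2)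
    (fun k => if k = 0 then ((1 / 2 : ℝ) : ℂ) else if k = 2 then a₂ - b₂ * Complex.I else 0) 2
    le_rfl (by norm_num) (by simp) (by simp) (by simpa using hg) (by norm_num)
  rw [← quadraticSupport_eq_trigSupport] at hsix hf
  have hrot := quadraticSupport_eq_rotorSupport a₁ b₁ a₂ b₂
  refine ⟨⟨le_rfl, by norm_num, 1, _, _, hrot ▸ hconv, congrArg supportCurve hrot⟩,
    not_isCircle_of_six_le hsix, f, hf,
    le_antisymm ?_ (hsix f hf.1.ne_zero ((hf.2 f).mpr dvd_rfl))⟩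
  obtain ⟨q, hq0, hq, hqv⟩ := exists_sextic_of_quadraticSupport a₁ b₁ a₂ b₂
  exact (MvPolynomial.totalDegree_le_of_dvd_of_isDomain ((hf.2 q).mp hqv) hq0).trans hq

theorem mainTheorem6 :
    -- every non-circular algebraic rotor has a defining polynomial
    (∀ C ∈ algebraicRotors, ¬ IsCircle C → ∃ f, IsDefiningPolynomial f C) ∧
    -- the minimal total degree of these polynomials is 6
    IsLeast {d : ℕ | ∃ C ∈ algebraicRotors, ¬ IsCircle C ∧
      ∃ f, IsDefiningPolynomial f C ∧ f.totalDegree = d} 6 ∧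
    -- it is attained by every member of the family that satisfies the convexity constraint
    (∀ a₁ b₁ a₂ b₂ : ℝ, (a₂ ≠ 0 ∨ b₂ ≠ 0) →
      ConvexityConstraint (quadraticSupport a₁ b₁ a₂ b₂) →
      IsAlgebraicRotor 3 (1 / 2) (supportCurve (quadraticSupport a₁ b₁ a₂ b₂)) ∧
      ¬ IsCircle (supportCurve (quadraticSupport a₁ b₁ a₂ b₂)) ∧
      ∃ f, IsDefiningPolynomial f (supportCurve (quadraticSupport a₁ b₁ a₂ b₂)) ∧
        f.totalDegree = 6) ∧
    -- the convexity constraint holds as soon as the second harmonic is small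
    (∃ ε : ℝ, 0 < ε ∧ ∀ a₁ b₁ a₂ b₂ : ℝ, |a₂| < ε → |b₂| < ε →
      ConvexityConstraint (quadraticSupport a₁ b₁ a₂ b₂)) ∧
    -- the example p(θ) = 1/2 + (1/6) cos 2θ
    (ConvexityConstraint (fun θ : ℝ => 1 / 2 + 1 / 6 * Real.cos (2 * θ)) ∧
      IsAlgebraicRotor 3 (1 / 2)
        (supportCurve (fun θ : ℝ => 1 / 2 + 1 / 6 * Real.cos (2 * θ))) ∧
      ¬ IsCircle (supportCurve (fun θ : ℝ => 1 / 2 + 1 / 6 * Real.cos (2 * θ))) ∧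
      ∃ f, IsDefiningPolynomial f
          (supportCurve (fun θ : ℝ => 1 / 2 + 1 / 6 * Real.cos (2 * θ))) ∧
        f.totalDegree = 6) := by
  have hex : (fun θ : ℝ => 1 / 2 + 1 / 6 * Real.cos (2 * θ)) = quadraticSupport 0 0 (1 / 6) 0 := by
    funext θ
    simp [quadraticSupport]
  have hconv : ConvexityConstraint (quadraticSupport 0 0 (1 / 6) 0) :=
    convexityConstraint_quadraticSupport _ _ _ _ (by norm_num)
  have hsextic := quadraticSupport_sextic 0 0 (1 / 6) 0 (by norm_num) hconv
  refine ⟨fun C hC hcirc => ?_, ⟨?_, ?_⟩, quadraticSupport_sextic,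
    ⟨1 / 12, by norm_num, fun a₁ b₁ a₂ b₂ ha hb =>
      convexityConstraint_quadraticSupport _ _ _ _ (by linarith)⟩, ?_⟩
  · obtain ⟨α, β, ρ, g, N, hN, hρ, h0, h1, hgN, h3, rfl⟩ :=
      exists_trigSupport_of_mem_algebraicRotors C hC hcirc
    exact exists_isDefiningPolynomial_trigSupport α β ρ g N hN hρ h0 h1 hgN h3
  · exact ⟨_, ⟨3, 1 / 2, hsextic.1⟩, hsextic.2.1, hsextic.2.2⟩
  · rintro d ⟨C, hC, hcirc, f, hf, rfl⟩
    obtain ⟨α, β, ρ, g, N, hN, hρ, h0, h1, hgN, h3, rfl⟩ :=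
      exists_trigSupport_of_mem_algebraicRotors C hC hcirc
    exact six_le_totalDegree_of_vanish α β ρ g N hN hρ h0 h1 hgN h3 f hf.1.ne_zero
      ((hf.2 f).mpr dvd_rfl)
  · rw [hex]
    exact ⟨hconv, hsextic⟩
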